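/- Let $\Delta_+$ be the category of the finite nonempty ordinals $[n]=\{0<\dots<n\}$ and injective monotone maps. A semisimplicial set is a presheaf on $\Delta_+$; write $\Delta^n$ for the representable one and, for $n\ge 1$ and $0\le k\le n$, $\Lambda^n_k\subseteq\Delta^n$ for the horn of all simplices whose image together with $k$ is not all of $[n]$. Fibrations are the maps with the right lifting property against all horn inclusions $\Lambda^n_k\to\Delta^n$; anodyne maps are the maps with the left lifting property against all fibrations; $X$ is fibrant if $X\to 1$ is a fibration. The geometric product $A\otimes B$ has as $n$-simplices the quadruples $(p,a,q,b)$ with $p\colon[n]\to[k]$ and $q\colon[n]\to[l]$ monotone surjections that are jointly injective, $a\in A_k$ and $b\in B_l$. An injection $f\colon[m]\to[n]$ acts by factoring $pf=f_0p'$ and $qf=f_1q'$ into surjections $p',q'$ followed by injections $f_0,f_1$, and returning $(p',\,a f_0,\,q',\,b f_1)$. The canonical comparison map $A\times B\to A\otimes B$ sends an $n$-simplex $(a,b)$ to $(\mathrm{id}_{[n]},a,\mathrm{id}_{[n]},b)$. A homotopy $f_0\sim f_1$ between maps $X\to Y$ is a map $\Delta^1\otimes X\to Y$ that restricts to $f_0$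 and $f_1$ along the inclusions $X\cong\Delta^0\otimes X\to\Delta^1\otimes X$ given by the vertices $0$ and $1$ of $\Delta^1$. A map $f\colon X\to Y$ is a homotopy equivalence if there is $g\colon Y\to X$ with $gf\sim\mathrm{id}_X$ and $fg\sim\mathrm{id}_Y$. A map $A\to B$ is a weak equivalence if there are fibrant $X,Y$, anodyne maps $A\to X$ and $B\to Y$, and a homotopy equivalence $X\to Y$ making the square commute. Theorem. For all fibrant semisimplicial sets $X$ and $Y$, the canonical comparison map \[ X\times Y\to X\otimes Y \] from the cartesian to the geometric product is a weak equivalence. -/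

import Mathlib

open CategoryTheory Limits Opposite Simplicial

universe u

/-- Semisimplicial sets: presheaves on the category of finite nonempty ordinals `[n]` and injective
monotone maps. -/
abbrev SemiSSet : Type (u + 1) := SemiSimplexCategoryᵒᵖ ⥤ Type u

namespace SemiSSet

/-! ### Representables, horns, anodyne maps and fibrations -/

/-- The representable semisimplicial set `Δⁿ`. -/
abbrev stdSimplex (n : ℕ) : SemiSSet.{u} := uliftYoneda.{u}.obj ⦋n⦌ₛ

/-- The `m`-simplices of `Δⁿ` are the maps `[m] → [n]` of the semisimplex category. -/
def stdSimplex.objEquiv {n : ℕ} {m : SemiSimplexCategoryᵒᵖ} :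
    (stdSimplex.{u} n).obj m ≃ (m.unop ⟶ ⦋n⦌ₛ) where
  toFun s := ULift.down s
  invFun f := ULift.up f

lemma stdSimplex.objEquiv_map {n : ℕ} {m m' : SemiSimplexCategoryᵒᵖ} (φ : m ⟶ m')
    (s : (stdSimplex.{u} n).obj m) :
    stdSimplex.objEquiv ((stdSimplex.{u} n).map φ s) = φ.unop ≫ stdSimplex.objEquiv s :=
  have aux {C : Type} [Category.{0} C] {X : C} {m m' : Cᵒᵖ} (φ : m ⟶ m')
      (s : (uliftYoneda.{u}.obj X).obj m) :
      ULift.down ((uliftYoneda.{u}.obj X).map φ s) = φ.unop ≫ ULift.down s := rfl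
  aux φ s

/-- The monotone injection underlying a simplex of `Δⁿ`. -/
def stdSimplex.toFun {n : ℕ} {m : SemiSimplexCategoryᵒᵖ} (s : (stdSimplex.{u} n).obj m) :
    Fin (m.unop.len + 1) → Fin (n + 1) :=
  SemiSimplexCategory.homEquiv (stdSimplex.objEquiv s)

lemma stdSimplex.toFun_map {n : ℕ} {m m' : SemiSimplexCategoryᵒᵖ} (φ : m ⟶ m')
    (s : (stdSimplex.{u} n).obj m) (i : Fin (m'.unop.len + 1)) :
    stdSimplex.toFun ((stdSimplex.{u} n).map φ s) i =
      stdSimplex.toFun s (SemiSimplexCategory.homEquiv φ.unop i) := by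
  rw [stdSimplex.toFun, stdSimplex.objEquiv_map, SemiSimplexCategory.homEquiv_comp]
  exact RelEmbedding.trans_apply _ _ _

/-- The horn `Λⁿ_k ⊆ Δⁿ`: the simplices whose image together with `k` is not all of `[n]`. -/
def horn (n : ℕ) (k : Fin (n + 1)) : Subfunctor (stdSimplex.{u} n) where
  obj _ := {s | Set.range (stdSimplex.toFun s) ∪ {k} ≠ Set.univ}
  map {U V} φ s hs h := hs (by
    rw [Set.eq_univ_iff_forall] at h ⊢
    intro j
    refine (h j).imp ?_ id
    rintro ⟨i, hi⟩
    exact ⟨SemiSimplexCategory.homEquiv φ.unop i, (stdSimplex.toFun_map φ s i).symm.trans hi⟩)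

/-- The set of horn inclusions `Λⁿ_k → Δⁿ` with `n ≥ 1` and `0 ≤ k ≤ n`. -/
def hornInclusions : MorphismProperty SemiSSet.{u} :=
  MorphismProperty.ofHoms (fun i : (n : ℕ) × Fin (n + 2) ↦ (horn.{u} (i.1 + 1) i.2).ι)

/-- Fibrations: the maps with the right lifting property against all horn inclusions. -/
def fibrations : MorphismProperty SemiSSet.{u} := hornInclusions.rlp

/-- Anodyne maps: the left class of the weak factorization system generated by horn inclusions. -/
def anodyne : MorphismProperty SemiSSet.{u} := fibrations.llp

/-- A semisimplicial set is fibrant if its map to the terminal object is a fibration. -/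
def IsFibrant (X : SemiSSet.{u}) : Prop := fibrations (terminal.from X)

/-! ### The free simplicial set on a semisimplicial set -/

/-- An `n`-simplex of the free simplicial set on `A`: an epimorphism `p : [n] → [a]` of the simplex
category, together with an `a`-simplex of `A`. -/
structure FreeSimplex (A : SemiSSet.{u}) (n : SimplexCategory) : Type u where
  /-- the object `[a]` -/
  base : SemiSimplexCategory
  /-- the epimorphism `[n] → [a]` -/
  proj : n ⟶ SemiSimplexCategory.toSimplexCategory.obj base
  epi : Epi proj
  /-- the `a`-simplex of `A` -/
  simplex : A.obj (op base)

namespace FreeSimplex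

variable {A : SemiSSet.{u}}

/-- The monomorphism in the epi-mono factorization of `p f`, for `f : [m] → [n]`. -/
noncomputable def face {m n : SimplexCategory} (f : m ⟶ n) (s : FreeSimplex A n) :
    ⦋(image (f ≫ s.proj)).len⦌ₛ ⟶ s.base :=
  @SemiSimplexCategory.homOfMono ⦋(image (f ≫ s.proj)).len⦌ₛ s.base (image.ι (f ≫ s.proj))
    (inferInstanceAs (Mono (image.ι (f ≫ s.proj))))

lemma map_face {m n : SimplexCategory} (f : m ⟶ n) (s : FreeSimplex A n) :
    SemiSimplexCategory.toSimplexCategory.map (face f s) = image.ι (f ≫ s.proj) :=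
  @SemiSimplexCategory.toSimplexCategory_map_homOfMono ⦋(image (f ≫ s.proj)).len⦌ₛ s.base _
    (inferInstanceAs (Mono (image.ι (f ≫ s.proj))))

/-- The action of a map `f : [m] → [n]` on `(p : [n] → [a], x)`: factor `p f` as an epimorphism
`p'` followed by a monomorphism `f₀`, and return `(p', x f₀)`. -/
noncomputable def restrict {m n : SimplexCategory} (f : m ⟶ n) (s : FreeSimplex A n) :
    FreeSimplex A m where
  base := ⦋(image (f ≫ s.proj)).len⦌ₛ
  proj := factorThruImage (f ≫ s.proj)
  epi := inferInstanceAs (Epi (factorThruImage (f ≫ s.proj)))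
  simplex := A.map (face f s).op s.simplex

/-- The action may be computed with any epi-mono factorization. -/
lemma restrict_eq {m n : SimplexCategory} (f : m ⟶ n) (s : FreeSimplex A n)
    (b : SemiSimplexCategory) (e : m ⟶ SemiSimplexCategory.toSimplexCategory.obj b) (he : Epi e)
    (i : b ⟶ s.base) (fac : e ≫ SemiSimplexCategory.toSimplexCategory.map i = f ≫ s.proj) :
    restrict f s = ⟨b, e, he, A.map i.op s.simplex⟩ := by
  have hb : b = ⦋(image (f ≫ s.proj)).len⦌ₛ :=
    SemiSimplexCategory.ext (congrArg SimplexCategory.len (SimplexCategory.image_eq fac)).symm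
  subst hb
  have h₁ : factorThruImage (f ≫ s.proj) = e :=
    @SimplexCategory.factorThruImage_eq _ _ _ e he _
      (inferInstanceAs (Mono (SemiSimplexCategory.toSimplexCategory.map i))) fac
  have h₂ : face f s = i := by
    apply SemiSimplexCategory.toSimplexCategory.map_injective
    rw [map_face]
    exact @SimplexCategory.image_ι_eq _ _ _ e he _
      (inferInstanceAs (Mono (SemiSimplexCategory.toSimplexCategory.map i))) fac
  subst h₁ h₂
  rfl

lemma restrict_spec {m n : SimplexCategory} (f : m ⟶ n) (s : FreeSimplex A n) :
    ∃ i : (restrict f s).base ⟶ s.base,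
      (restrict f s).proj ≫ SemiSimplexCategory.toSimplexCategory.map i = f ≫ s.proj ∧
        (restrict f s).simplex = A.map i.op s.simplex :=
  ⟨face f s, (congrArg _ (map_face f s)).trans (image.fac (f ≫ s.proj)), rfl⟩

lemma restrict_id {n : SimplexCategory} (s : FreeSimplex A n) : restrict (𝟙 n) s = s := by
  rw [restrict_eq (𝟙 n) s s.base s.proj s.epi (𝟙 _) (by simp)]
  simp

lemma restrict_comp {l m n : SimplexCategory} (g : l ⟶ m) (f : m ⟶ n) (s : FreeSimplex A n) :
    restrict (g ≫ f) s = restrict g (restrict f s) := by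
  obtain ⟨i, hi, hi'⟩ := restrict_spec f s
  obtain ⟨j, hj, hj'⟩ := restrict_spec g (restrict f s)
  rw [restrict_eq (g ≫ f) s (restrict g (restrict f s)).base (restrict g (restrict f s)).proj
    (restrict g (restrict f s)).epi (j ≫ i)
    (by rw [Functor.map_comp, ← Category.assoc, hj, Category.assoc, hi, Category.assoc])]
  have h : A.map (j ≫ i).op s.simplex = (restrict g (restrict f s)).simplex := by
    rw [hj', hi']
    simp
  rw [h]

/-- The `n`-simplex `(id : [n] → [n], x)` of `L A`. -/
def ofSimplex {n : SemiSimplexCategory} (x : A.obj (op n)) :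
    FreeSimplex A (SemiSimplexCategory.toSimplexCategory.obj n) :=
  ⟨n, 𝟙 _, inferInstance, x⟩

lemma restrict_ofSimplex {m n : SemiSimplexCategory} (f : m ⟶ n) (x : A.obj (op n)) :
    restrict (SemiSimplexCategory.toSimplexCategory.map f) (ofSimplex x) =
      ofSimplex (A.map f.op x) :=
  restrict_eq _ (ofSimplex x) m (𝟙 _) inferInstance f (by simp [ofSimplex])

/-- The `n`-simplex `([n] → [0], v)` of `L A`. -/
def ofVertex (n : SimplexCategory) (v : A.obj (op ⦋0⦌ₛ)) : FreeSimplex A n :=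
  ⟨⦋0⦌ₛ, SimplexCategory.const n ⦋0⦌ 0,
    SimplexCategory.epi_iff_surjective.2 (fun _ ↦ ⟨0, Subsingleton.elim (α := Fin 1) _ _⟩), v⟩

lemma restrict_ofVertex {m n : SimplexCategory} (f : m ⟶ n) (v : A.obj (op ⦋0⦌ₛ)) :
    restrict f (ofVertex n v) = ofVertex m v := by
  rw [restrict_eq f (ofVertex n v) ⦋0⦌ₛ (SimplexCategory.const m ⦋0⦌ 0) (ofVertex m v).epi (𝟙 _)
    (Subsingleton.elim (α := m ⟶ ⦋0⦌) _ _)]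
  have h : A.map (𝟙 (⦋0⦌ₛ : SemiSimplexCategory)).op v = v := by simp
  change (⟨_, _, _, A.map (𝟙 (⦋0⦌ₛ : SemiSimplexCategory)).op v⟩ : FreeSimplex A m) = _
  rw [h]
  rfl

end FreeSimplex

/-- The free simplicial set `L A` on a semisimplicial set `A`. -/
noncomputable def free (A : SemiSSet.{u}) : SSet.{u} where
  obj n := FreeSimplex A n.unop
  map f := ↾(FreeSimplex.restrict f.unop)
  map_id n := by
    ext s
    exact FreeSimplex.restrict_id s
  map_comp f g := by
    ext s
    exact FreeSimplex.restrict_comp g.unop f.unop s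

/-- The underlying semisimplicial set `U K` of a simplicial set `K`. -/
abbrev forget (K : SSet.{u}) : SemiSSet.{u} := SemiSimplexCategory.toSimplexCategory.op ⋙ K

/-- The unit `η : A → U L A`, sending `x ∈ A_n` to `(id : [n] → [n], x)`. -/
noncomputable def unit (A : SemiSSet.{u}) : A ⟶ forget (free A) where
  app n := ↾fun x ↦ FreeSimplex.ofSimplex x
  naturality n m f := by
    ext x
    exact (FreeSimplex.restrict_ofSimplex f.unop x).symm

/-! ### The cartesian and the geometric product -/

/-- The cartesian product, with `n`-simplices `A_n × B_n`. -/
abbrev cartesianProduct (A B : SemiSSet.{u}) : SemiSSet.{u} := FunctorToTypes.prod A B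

/-- The `n`-simplices of the geometric product as a subset of those of `U L A × U L B`: the
quadruples `(p : [n] → [a], x ∈ A_a, q : [n] → [b], y ∈ B_b)` with `p`, `q` epimorphisms that are
jointly monic. -/
noncomputable def geometricSubfunctor (A B : SemiSSet.{u}) :
    Subfunctor (cartesianProduct (forget (free A)) (forget (free B))) where
  obj n := Set.ofPred (fun s : FreeSimplex A (SemiSimplexCategory.toSimplexCategory.obj n.unop) ×
      FreeSimplex B (SemiSimplexCategory.toSimplexCategory.obj n.unop) ↦
    ∀ i j : Fin (n.unop.len + 1), s.1.proj.toOrderHom i = s.1.proj.toOrderHom j →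
      s.2.proj.toOrderHom i = s.2.proj.toOrderHom j → i = j)
  map {n m} f := by
    rintro ⟨s, t⟩ h i j hs ht
    obtain ⟨a, ha, -⟩ :=
      FreeSimplex.restrict_spec (SemiSimplexCategory.toSimplexCategory.map f.unop) s
    obtain ⟨b, hb, -⟩ :=
      FreeSimplex.restrict_spec (SemiSimplexCategory.toSimplexCategory.map f.unop) t
    have key {x y z w : SimplexCategory} {e : x ⟶ y} {k : y ⟶ z} {g : x ⟶ w} {p : w ⟶ z}
        (hh : e ≫ k = g ≫ p) {i j : Fin (x.len + 1)} (hij : e.toOrderHom i = e.toOrderHom j) :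
        p.toOrderHom (g.toOrderHom i) = p.toOrderHom (g.toOrderHom j) := by
      have h₁ := SimplexCategory.congr_toOrderHom_apply hh i
      have h₂ := SimplexCategory.congr_toOrderHom_apply hh j
      simp only [SimplexCategory.comp_toOrderHom, OrderHom.comp_coe, Function.comp_apply]
        at h₁ h₂
      rw [← h₁, ← h₂, hij]
    exact (SemiSimplexCategory.homEquiv f.unop).injective (h _ _ (key ha hs) (key hb ht))

/-- The geometric product `A ⊗ B`. -/
noncomputable abbrev geometricProduct (A B : SemiSSet.{u}) : SemiSSet.{u} :=
  (geometricSubfunctor A B).toFunctor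

/-- The canonical comparison map `A × B → A ⊗ B`, sending `(x, y) ∈ A_n × B_n` to
`(id : [n] → [n], x, id : [n] → [n], y)`. -/
noncomputable def comparison (A B : SemiSSet.{u}) :
    cartesianProduct A B ⟶ geometricProduct A B :=
  Subfunctor.lift
    (FunctorToTypes.prod.lift (FunctorToTypes.prod.fst ≫ unit A)
      (FunctorToTypes.prod.snd ≫ unit B))
    (by
      rintro n _ ⟨x, rfl⟩
      exact fun i j (hi : i = j) _ ↦ hi)

/-! ### Homotopies and weak equivalences -/

/-- The map `X → A ⊗ X` given by a vertex `v` of `A`, i.e. `v ⊗ X : Δ⁰ ⊗ X → A ⊗ X` precomposed with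
the unit isomorphism `X ≅ Δ⁰ ⊗ X`. It sends `x ∈ X_n` to `([n] → [0], v, id : [n] → [n], x)`. -/
noncomputable def vertexInclusion {A : SemiSSet.{u}} (v : A.obj (op ⦋0⦌ₛ)) (X : SemiSSet.{u}) :
    X ⟶ geometricProduct A X where
  app n := ↾fun x ↦ (⟨(FreeSimplex.ofVertex _ v, FreeSimplex.ofSimplex x),
    fun i j _ (h : i = j) ↦ h⟩ : {s // s ∈ (geometricSubfunctor A X).obj n})
  naturality n m f := by
    ext x
    exact Subtype.ext (Prod.ext (FreeSimplex.restrict_ofVertex _ v).symm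
      (FreeSimplex.restrict_ofSimplex f.unop x).symm)

/-- The vertex `k` of `Δⁿ`. -/
def vertex {n : ℕ} (k : Fin (n + 1)) : (stdSimplex.{u} n).obj (op ⦋0⦌ₛ) :=
  stdSimplex.objEquiv.symm (SemiSimplexCategory.homEquiv.symm
    (OrderEmbedding.ofStrictMono (fun _ : Fin 1 ↦ k) (Subsingleton.strictMono (α := Fin 1) _)))

/-- A homotopy `f₀ ∼ f₁` is a map `Δ¹ ⊗ X → Y` that restricts to `f₀` and `f₁` at the two ends. -/
def Homotopic {X Y : SemiSSet.{u}} (f₀ f₁ : X ⟶ Y) : Prop :=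
  ∃ h : geometricProduct (stdSimplex.{u} 1) X ⟶ Y,
    vertexInclusion (vertex 0) X ≫ h = f₀ ∧ vertexInclusion (vertex 1) X ≫ h = f₁

/-- Homotopy equivalences. -/
def IsHomotopyEquivalence {X Y : SemiSSet.{u}} (f : X ⟶ Y) : Prop :=
  ∃ g : Y ⟶ X, Homotopic (f ≫ g) (𝟙 X) ∧ Homotopic (g ≫ f) (𝟙 Y)

/-- A map `f : A → B` is a weak equivalence if it extends along some anodyne maps `A → X`, `B → Y`
with `X`, `Y` fibrant to a homotopy equivalence `X → Y`. -/
def IsWeakEquivalence {A B : SemiSSet.{u}} (f : A ⟶ B) : Prop :=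
  ∃ (X Y : SemiSSet.{u}) (j : A ⟶ X) (k : B ⟶ Y) (g : X ⟶ Y),
    IsFibrant X ∧ IsFibrant Y ∧ anodyne j ∧ anodyne k ∧ j ≫ g = f ≫ k ∧
      IsHomotopyEquivalence g

end SemiSSet

/-!
The proof compares `X ⊗ Y` with a product of Kan complexes. Write `L` for the free simplicial set,
`U` for the forgetful functor and `η : A → U L A` for the unit.

* The combinatorial core is `anodyne_noncollapsing_sup`. In a simplicial set `K` in which the faces
  of nondegenerate simplices are nondegenerate (such as `L A`, `L A × L B` or `Δ[n]`), the
  nondegenerate simplices, possibly enlarged by a subcomplex, form a subobject of `U K`, and its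
  inclusion is anodyne. It is a retract of an inclusion into a cylinder on `U K`, whose simplices may
  be degenerate over one end only, namely the inclusion of the nondegenerate simplices of that end
  together with everything over the subcomplex. The cylinder is built from this part by filling
  horns, organised by a pairing of simplices (`HornPairing.anodyne`, `cylinderPairing`).
* Consequently `η : A → U L A` and `A ⊗ B → U (L A × L B)` are anodyne, and `U` sends simplicial
  horn inclusions, hence all anodyne extensions, to anodyne maps (`anodyne_whiskerLeft`). It also
  preserves fibrations (`fibrations_whiskerLeft`).
* Choose anodyne extensions `L X → K` and `L Y → K'` with `K`, `K'` Kan complexes. Then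
  `X ⊗ Y → U (L X × L Y) → U (K × K') ≅ U K × U K'` is anodyne with fibrant target, and its
  composite with the comparison map is the product of the anodyne maps `X → U K` and `Y → U K'`.
* An anodyne map from a fibrant object `X` to `U K` has a retraction, and maps to `U K` that agree
  along an anodyne map are homotopic, by lifting against the path fibration of `K`
  (`homotopic_of_anodyne`). So `X → U K` and `Y → U K'` are homotopy equivalences, and so is
  their product.
-/

/-! ### Faces and horns -/

namespace SemiSimplexCategory

/-- The `k`-th coface map `[n] → [n + 1]`, the injection whose image omits `k`. -/
def coface {n : ℕ} (k : Fin (n + 2)) : ⦋n⦌ₛ ⟶ ⦋n + 1⦌ₛ :=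
  homEquiv.symm (Fin.succAboveOrderEmb k)

/-- The maps into `[n + 1]` outside the horn `Λ^{n+1}_k` are the identity and the `k`-th coface. -/
lemma heq_id_or_coface {l n : ℕ} (f : ⦋l⦌ₛ ⟶ ⦋n + 1⦌ₛ) (k : Fin (n + 2))
    (hf : Set.range (homEquiv f) ∪ {k} = Set.univ) :
    (l = n + 1 ∧ f ≍ 𝟙 (⦋n + 1⦌ₛ : SemiSimplexCategory)) ∨ (l = n ∧ f ≍ coface k) := by
  have h1 : l + 1 ≤ n + 2 := by
    simpa using Fintype.card_le_of_injective _ (homEquiv f).injective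
  have h2 : n + 2 ≤ l + 1 + 1 := by
    have h3 : (Finset.univ.image (homEquiv f) ∪ {k} : Finset (Fin (n + 2))) = Finset.univ := by
      apply Finset.coe_injective
      simpa using hf
    have h4 := congrArg Finset.card h3
    have h5 := Finset.card_union_le (Finset.univ.image (homEquiv f)) ({k} : Finset (Fin (n + 2)))
    have h6 := Finset.card_image_le (s := Finset.univ) (f := homEquiv f)
    simp only [Finset.card_univ, Fintype.card_fin, Finset.card_singleton] at h4 h5 h6
    have h7 : Fintype.card (Fin ((⦋n + 1⦌ₛ : SemiSimplexCategory).len + 1)) = n + 2 :=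
      Fintype.card_fin _
    have h8 : Fintype.card (Fin ((⦋l⦌ₛ : SemiSimplexCategory).len + 1)) = l + 1 :=
      Fintype.card_fin _
    omega
  obtain rfl | rfl : l = n + 1 ∨ l = n := by omega
  · refine Or.inl ⟨rfl, heq_of_eq ?_⟩
    ext i : 2
    have := Subsingleton.elim (α := Fin (n + 2) ≃o Fin (n + 2))
      (OrderIso.ofSurjective (homEquiv f)
        (Finite.surjective_of_injective (homEquiv f).injective)) (OrderIso.refl _)
    exact congrArg (fun e : Fin (n + 2) ≃o Fin (n + 2) ↦ e i) this
  · refine Or.inr ⟨rfl, heq_of_eq ?_⟩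
    have hk : k ∉ Set.range (homEquiv f) := by
      intro hk
      have hs : Function.Surjective (homEquiv f) := by
        rw [← Set.range_eq_univ, ← hf, Set.union_eq_self_of_subset_right]
        simpa using hk
      have := Fintype.card_le_of_surjective _ hs
      simp at this
    have hr : Set.range (homEquiv f) = Set.range (Fin.succAboveOrderEmb k) := by
      ext j
      change _ ↔ j ∈ Set.range k.succAbove
      rw [Fin.range_succAbove, Set.mem_compl_iff, Set.mem_singleton_iff]
      constructor
      · rintro hj rfl
        exact hk hj
      · intro hj
        have : j ∈ Set.range (homEquiv f) ∪ {k} := hf ▸ Set.mem_univ j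
        exact this.resolve_right hj
    apply homEquiv.injective
    exact DFunLike.coe_injective
      (((homEquiv f).strictMono.range_inj (Fin.strictMono_succAbove k)).1 hr)

end SemiSimplexCategory

namespace SemiSSet

open SemiSimplexCategory

lemma mem_horn_iff {n : ℕ} (k : Fin (n + 1)) {m : SemiSimplexCategoryᵒᵖ}
    (s : (stdSimplex.{u} n).obj m) :
    s ∈ (horn n k).obj m ↔ Set.range (stdSimplex.toFun s) ∪ {k} ≠ Set.univ := Iff.rfl

lemma horn_ι_llp {E B : SemiSSet.{u}} {p : E ⟶ B} (hp : fibrations p) (n : ℕ) (k : Fin (n + 2)) :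
    HasLiftingProperty (horn.{u} (n + 1) k).ι p :=
  hp _ (MorphismProperty.ofHoms.mk (f := fun i : (n : ℕ) × Fin (n + 2) ↦
    (horn.{u} (i.1 + 1) i.2).ι) ⟨n, k⟩)

/-! ### Attaching simplices along horns -/

section Pairing

variable {X : SemiSSet.{u}} {A C : Subfunctor X}

/-- A family `P` of pairs `(y, k)`, each consisting of a simplex `y` and the index `k` of one of
its faces, that exhibits `C` as built from `A` by filling horns: each pair contributes the two
simplices `y` and `d_k y`, after the other proper faces of `y`. The order of attachment is given by
a rank function. -/
structure HornPairing (A C : Subfunctor X) (α : Type*) [Preorder α] where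
  /-- the pairs -/
  P : ∀ ⦃n : ℕ⦄, X.obj (op ⦋n + 1⦌ₛ) → Fin (n + 2) → Prop
  /-- the rank of a simplex -/
  rank : ∀ ⦃n : ℕ⦄, X.obj (op ⦋n⦌ₛ) → α
  mem : ∀ ⦃n⦄ ⦃y : X.obj (op ⦋n + 1⦌ₛ)⦄ ⦃k⦄, P y k → y ∈ C.obj _
  face_notMem : ∀ ⦃n⦄ ⦃y : X.obj (op ⦋n + 1⦌ₛ)⦄ ⦃k⦄, P y k → X.map (coface k).op y ∉ A.obj _
  cover : ∀ ⦃n⦄ (x : X.obj (op ⦋n⦌ₛ)), x ∈ C.obj _ → x ∉ A.obj _ →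
    ∃ (m : ℕ) (y : X.obj (op ⦋m + 1⦌ₛ)) (k : Fin (m + 2)) (f : ⦋n⦌ₛ ⟶ ⦋m + 1⦌ₛ),
      P y k ∧ X.map f.op y = x ∧ rank y ≤ rank x
  rank_lt : ∀ ⦃n⦄ ⦃y : X.obj (op ⦋n + 1⦌ₛ)⦄ ⦃k⦄, P y k → ∀ ⦃m : ℕ⦄ (f : ⦋m⦌ₛ ⟶ ⦋n + 1⦌ₛ),
    Set.range (homEquiv f) ∪ {k} ≠ Set.univ →
      X.map f.op y ∈ A.obj _ ∨ rank (X.map f.op y) < rank y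
  rank_face : ∀ ⦃n⦄ ⦃y : X.obj (op ⦋n + 1⦌ₛ)⦄ ⦃k⦄, P y k → rank (X.map (coface k).op y) = rank y
  face_inj : ∀ ⦃n⦄ ⦃y y' : X.obj (op ⦋n + 1⦌ₛ)⦄ ⦃k k'⦄, P y k → P y' k' →
    X.map (coface k).op y = X.map (coface k').op y' → y = y'
  face_ne : ∀ ⦃n⦄ ⦃y : X.obj (op ⦋n + 1⦌ₛ)⦄ ⦃y' : X.obj (op ⦋n + 1 + 1⦌ₛ)⦄ ⦃k k'⦄,
    P y k → P y' k' → X.map (coface k').op y' ≠ y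

variable {α : Type*} [Preorder α] (H : HornPairing A C α)

/-- The graph of a lift, defined on part of `C`, in a lifting problem with bottom map
`v : C → B` and right map `p : E → B`. Its domain contains with `d_k y` also `y`, for each pair
`(y, k)` of the pairing. -/
structure IsPartialLift {E B : SemiSSet.{u}} (H : HornPairing A C α) (p : E ⟶ B)
    (v : C.toFunctor ⟶ B) (G : Subfunctor (cartesianProduct X E)) : Prop where
  comm : ∀ ⦃n⦄ ⦃x : X.obj n⦄ ⦃e : E.obj n⦄, (x, e) ∈ G.obj n →
    ∃ hx : x ∈ C.obj n, p.app n e = v.app n ⟨x, hx⟩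
  unique : ∀ ⦃n⦄ ⦃x : X.obj n⦄ ⦃e e' : E.obj n⦄, (x, e) ∈ G.obj n → (x, e') ∈ G.obj n → e = e'
  closed : ∀ ⦃n⦄ ⦃y : X.obj (op ⦋n + 1⦌ₛ)⦄ ⦃k⦄ ⦃e : E.obj _⦄, H.P y k →
    (X.map (coface k).op y, e) ∈ G.obj _ → ∃ e', (y, e') ∈ G.obj _

namespace IsPartialLift

variable {H} {E B : SemiSSet.{u}} {p : E ⟶ B} {v : C.toFunctor ⟶ B}
  {G : Subfunctor (cartesianProduct X E)}

/-- A partial lift defined on all proper faces of `y` but the `k`-th determines, by filling a horn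
in `E`, a simplex over `y` compatible with it. -/
lemma exists_filler (hG : IsPartialLift H p v G) (hp : fibrations p) {n : ℕ}
    {y : X.obj (op ⦋n + 1⦌ₛ)} {k : Fin (n + 2)} (hy : y ∈ C.obj _)
    (hface : ∀ ⦃m : ℕ⦄ (f : ⦋m⦌ₛ ⟶ ⦋n + 1⦌ₛ), Set.range (homEquiv f) ∪ {k} ≠ Set.univ →
      ∃ e, (X.map f.op y, e) ∈ G.obj _) :
    ∃ e : E.obj (op ⦋n + 1⦌ₛ), p.app _ e = v.app _ ⟨y, hy⟩ ∧
      ∀ ⦃m : ℕ⦄ (f : ⦋m⦌ₛ ⟶ ⦋n + 1⦌ₛ), Set.range (homEquiv f) ∪ {k} ≠ Set.univ →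
        (X.map f.op y, E.map f.op e) ∈ G.obj _ := by
  have hs (m : SemiSimplexCategoryᵒᵖ) (s : ((horn.{u} (n + 1) k).toFunctor).obj m) :
      ∃ e, (X.map (stdSimplex.objEquiv s.1).op y, e) ∈ G.obj m := hface _ s.2
  choose φ hφ using hs
  let top : (horn.{u} (n + 1) k).toFunctor ⟶ E :=
    { app := fun m ↦ ↾(φ m)
      naturality := by
        intro m m' g
        ext s
        refine hG.unique (hφ m' _) ?_
        have h1 := G.map g (hφ m s)
        have h2 : X.map (stdSimplex.objEquiv ((stdSimplex (n + 1)).map g s.1)).op y =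
            X.map g (X.map (stdSimplex.objEquiv s.1).op y) := by
          rw [stdSimplex.objEquiv_map]
          simp
        change (X.map (stdSimplex.objEquiv ((stdSimplex (n + 1)).map g s.1)).op y, _) ∈ _
        rw [h2]
        exact h1 }
  let bot : stdSimplex.{u} (n + 1) ⟶ B :=
    { app := fun m ↦ ↾fun s ↦ v.app m (C.toFunctor.map (stdSimplex.objEquiv s).op ⟨y, hy⟩)
      naturality := by
        intro m m' g
        ext s
        change v.app m' (C.toFunctor.map (stdSimplex.objEquiv
          ((stdSimplex (n + 1)).map g s)).op ⟨y, hy⟩) = B.map g (v.app m _)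
        rw [stdSimplex.objEquiv_map, ← NatTrans.naturality_apply, op_comp, Functor.map_comp]
        rfl }
  have sq : CommSq top (horn.{u} (n + 1) k).ι p bot := ⟨by
    ext m s
    obtain ⟨_, h⟩ := hG.comm (hφ m s)
    exact h⟩
  have := horn_ι_llp hp n k
  let e := sq.lift.app _ (stdSimplex.objEquiv.symm (𝟙 ⦋n + 1⦌ₛ))
  have he : ∀ (m : SemiSimplexCategory) (f : m ⟶ ⦋n + 1⦌ₛ), E.map f.op e =
      sq.lift.app (op m) (stdSimplex.objEquiv.symm f) := by
    intro m f
    rw [← NatTrans.naturality_apply]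
    congr 1
    apply stdSimplex.objEquiv.injective
    rw [stdSimplex.objEquiv_map]
    simp
  refine ⟨e, ?_, ?_⟩
  · have h1 := ConcreteCategory.congr_hom (NatTrans.congr_app sq.fac_right (op ⦋n + 1⦌ₛ))
      (stdSimplex.objEquiv.symm (𝟙 ⦋n + 1⦌ₛ))
    refine h1.trans ?_
    change v.app _ (C.toFunctor.map (stdSimplex.objEquiv
      (stdSimplex.objEquiv.{u}.symm (𝟙 ⦋n + 1⦌ₛ))).op ⟨y, hy⟩) = _
    rw [Equiv.apply_symm_apply]
    exact congrArg (v.app (op ⦋n + 1⦌ₛ)) (ConcreteCategory.congr_hom (C.toFunctor.map_id _) ⟨y, hy⟩)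
  · intro m f hf
    let s : ((horn.{u} (n + 1) k).toFunctor).obj (op ⦋m⦌ₛ) := ⟨stdSimplex.objEquiv.symm f, hf⟩
    have h1 := ConcreteCategory.congr_hom (NatTrans.congr_app sq.fac_left (op ⦋m⦌ₛ)) s
    rw [he]
    have h2 : sq.lift.app (op ⦋m⦌ₛ) (stdSimplex.objEquiv.symm f) = φ _ s := h1
    rw [h2]
    exact hφ _ s

/-- A partial lift extends over `y` and `d_k y` if it is defined on the other proper faces. -/
lemma exists_extension (hG : IsPartialLift H p v G) (hp : fibrations p) {n : ℕ}
    {y : X.obj (op ⦋n + 1⦌ₛ)} {k : Fin (n + 2)} (hyk : H.P y k)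
    (hyG : ¬ ∃ e, (y, e) ∈ G.obj _)
    (hface : ∀ ⦃m : ℕ⦄ (f : ⦋m⦌ₛ ⟶ ⦋n + 1⦌ₛ), Set.range (homEquiv f) ∪ {k} ≠ Set.univ →
      ∃ e, (X.map f.op y, e) ∈ G.obj _) :
    ∃ G', G ≤ G' ∧ IsPartialLift H p v G' ∧ ∃ e, (y, e) ∈ G'.obj _ := by
  obtain ⟨e, hpe, he⟩ := hG.exists_filler hp (H.mem hyk) hface
  let z : (cartesianProduct X E).obj (op ⦋n + 1⦌ₛ) := (y, e)
  have hdG : ¬ ∃ e, (X.map (coface k).op y, e) ∈ G.obj _ := by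
    rintro ⟨e', he'⟩
    exact hyG (hG.closed hyk he')
  have key : ∀ ⦃m : ℕ⦄ ⦃x : X.obj (op ⦋m⦌ₛ)⦄ ⦃e' : E.obj (op ⦋m⦌ₛ)⦄,
      (x, e') ∈ (Subfunctor.ofSection z).obj _ → (x, e') ∈ G.obj _ ∨
        (m = n + 1 ∧ x ≍ y ∧ e' ≍ e) ∨
        (m = n ∧ x ≍ X.map (coface k).op y ∧ e' ≍ E.map (coface k).op e) := by
    rintro m x e' ⟨f, hf⟩
    obtain ⟨f, rfl⟩ : ∃ g : ⦋m⦌ₛ ⟶ ⦋n + 1⦌ₛ, f = g.op := ⟨f.unop, rfl⟩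
    obtain ⟨rfl, rfl⟩ := Prod.ext_iff.1 hf
    by_cases h : Set.range (homEquiv f) ∪ {k} = Set.univ
    · obtain ⟨rfl, h⟩ | ⟨rfl, h⟩ := heq_id_or_coface f k h
      · obtain rfl := eq_of_heq h
        refine Or.inr (Or.inl ⟨rfl, heq_of_eq ?_, heq_of_eq ?_⟩)
        · exact ConcreteCategory.congr_hom (X.map_id _) y
        · exact ConcreteCategory.congr_hom (E.map_id _) e
      · obtain rfl := eq_of_heq h
        exact Or.inr (Or.inr ⟨rfl, HEq.rfl, HEq.rfl⟩)
    · exact Or.inl (he f h)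
  refine ⟨G ⊔ Subfunctor.ofSection z, le_sup_left, ⟨?_, ?_, ?_⟩, e,
    Or.inr (Subfunctor.mem_ofSection_obj z)⟩
  · rintro m x e' (h | ⟨f, hf⟩)
    · exact hG.comm h
    · obtain ⟨rfl, rfl⟩ := Prod.ext_iff.1 hf
      refine ⟨C.map f (H.mem hyk), ?_⟩
      exact (NatTrans.naturality_apply p f e).trans ((congrArg (B.map f) hpe).trans
        (NatTrans.naturality_apply v f ⟨y, H.mem hyk⟩).symm)
  · rintro ⟨⟨m⟩⟩ x e₁ e₂ h₁ h₂
    have h₁' : (x, e₁) ∈ G.obj _ ∨ (m = n + 1 ∧ x ≍ y ∧ e₁ ≍ e) ∨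
        (m = n ∧ x ≍ X.map (coface k).op y ∧ e₁ ≍ E.map (coface k).op e) :=
      h₁.elim Or.inl (fun h ↦ key h)
    have h₂' : (x, e₂) ∈ G.obj _ ∨ (m = n + 1 ∧ x ≍ y ∧ e₂ ≍ e) ∨
        (m = n ∧ x ≍ X.map (coface k).op y ∧ e₂ ≍ E.map (coface k).op e) :=
      h₂.elim Or.inl (fun h ↦ key h)
    clear h₁ h₂
    obtain h₁ | ⟨rfl, hx, h₁⟩ | ⟨rfl, hx, h₁⟩ := h₁'
    · obtain h₂ | ⟨rfl, hx, -⟩ | ⟨rfl, hx, -⟩ := h₂'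
      · exact hG.unique h₁ h₂
      · obtain rfl := eq_of_heq hx
        exact (hyG ⟨_, h₁⟩).elim
      · obtain rfl := eq_of_heq hx
        exact (hdG ⟨_, h₁⟩).elim
    · obtain rfl := eq_of_heq hx
      obtain h₂ | ⟨-, -, h₂⟩ | ⟨h, -⟩ := h₂'
      · exact (hyG ⟨_, h₂⟩).elim
      · exact eq_of_heq (h₁.trans h₂.symm)
      · omega
    · obtain rfl := eq_of_heq hx
      obtain h₂ | ⟨h, -⟩ | ⟨-, -, h₂⟩ := h₂'
      · exact (hdG ⟨_, h₂⟩).elim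
      · omega
      · exact eq_of_heq (h₁.trans h₂.symm)
  · rintro m y' k' e' hy' (h | h)
    · obtain ⟨e'', he''⟩ := hG.closed hy' h
      exact ⟨e'', Or.inl he''⟩
    · obtain h | ⟨rfl, hx, -⟩ | ⟨rfl, hx, -⟩ := key h
      · obtain ⟨e'', he''⟩ := hG.closed hy' h
        exact ⟨e'', Or.inl he''⟩
      · exact (H.face_ne hyk hy' (eq_of_heq hx)).elim
      · obtain rfl := H.face_inj hy' hyk (eq_of_heq hx)
        exact ⟨e, Or.inr (Subfunctor.mem_ofSection_obj z)⟩

/-- The union of a nonempty chain of partial lifts is a partial lift. -/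
lemma sSup_of_isChain {c : Set (Subfunctor (cartesianProduct X E))}
    (hc : ∀ G ∈ c, IsPartialLift H p v G) (hc' : IsChain (· ≤ ·) c) :
    IsPartialLift H p v (sSup c) := by
  have mem {n} {z : (cartesianProduct X E).obj n} :
      z ∈ (sSup c).obj n ↔ ∃ G ∈ c, z ∈ G.obj n := by
    simp [Subfunctor.sSup_obj]
  refine ⟨?_, ?_, ?_⟩
  · intro n x e h
    obtain ⟨G, hG, h⟩ := mem.1 h
    exact (hc G hG).comm h
  · intro n x e e' h h'
    obtain ⟨G, hG, h⟩ := mem.1 h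
    obtain ⟨G', hG', h'⟩ := mem.1 h'
    obtain hle | hle := hc'.total hG hG'
    · exact (hc G' hG').unique (hle _ h) h'
    · exact (hc G hG).unique h (hle _ h')
  · intro n y k e hy h
    obtain ⟨G, hG, h⟩ := mem.1 h
    obtain ⟨e', he'⟩ := (hc G hG).closed hy h
    exact ⟨e', mem.2 ⟨G, hG, he'⟩⟩

end IsPartialLift

/-- An inclusion that admits a horn pairing with well-founded ranks is anodyne: by Zorn's lemma a
lifting problem against a fibration has a maximal partial solution, and a missing simplex of least
rank could be added by filling a horn. -/
theorem HornPairing.anodyne [WellFoundedLT α] (H : HornPairing A C α) (hAC : A ≤ C) :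
    anodyne (Subfunctor.homOfLe hAC) := by
  intro E B p hp
  refine ⟨fun {u v} sq ↦ ?_⟩
  let G₀ : Subfunctor (cartesianProduct X E) :=
    { obj := fun n ↦ Set.ofPred (fun z : X.obj n × E.obj n ↦
        ∃ h : z.1 ∈ A.obj n, u.app n ⟨z.1, h⟩ = z.2)
      map := by
        rintro n m f ⟨x, e⟩ ⟨h, he⟩
        exact ⟨A.map f h, (NatTrans.naturality_apply u f ⟨x, h⟩).trans (congrArg (E.map f) he)⟩ }
  have hG₀ : IsPartialLift H p v G₀ := by
    refine ⟨?_, ?_, ?_⟩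
    · rintro n x e ⟨h, he⟩
      exact ⟨hAC _ h, (congrArg (p.app n) he.symm).trans
        (ConcreteCategory.congr_hom (NatTrans.congr_app sq.w n) ⟨x, h⟩)⟩
    · rintro n x e e' ⟨h, he⟩ ⟨h', he'⟩
      exact he.symm.trans he'
    · rintro n y k e hy ⟨h, -⟩
      exact (H.face_notMem hy h).elim
  obtain ⟨G, hle, hG⟩ := zorn_le_nonempty₀ {G | IsPartialLift H p v G}
    (fun c hc hc' _ _ ↦ ⟨sSup c, .sSup_of_isChain hc hc', fun _ ↦ le_sSup⟩) G₀ hG₀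
  have total : ∀ (r : α) ⦃n : ℕ⦄ (x : X.obj (op ⦋n⦌ₛ)), x ∈ C.obj _ → H.rank x = r →
      ∃ e, (x, e) ∈ G.obj _ := by
    intro r
    induction r using WellFoundedLT.induction with
    | ind r ih =>
      rintro n x hx rfl
      by_cases hxA : x ∈ A.obj _
      · exact ⟨u.app _ ⟨x, hxA⟩, hle _ ⟨hxA, rfl⟩⟩
      obtain ⟨m, y, k, f, hy, rfl, hr⟩ := H.cover x hx hxA
      have : ∃ e, (y, e) ∈ G.obj _ := by
        by_contra hyG
        obtain ⟨G', hGG', hG', e, he⟩ := hG.prop.exists_extension hp hy hyG (by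
          intro l g hg
          obtain h | h := H.rank_lt hy g hg
          · exact ⟨u.app _ ⟨_, h⟩, hle _ ⟨h, rfl⟩⟩
          · exact ih _ (h.trans_le hr) _ (C.map _ (H.mem hy)) rfl)
        exact hyG ⟨e, hG.le_of_ge hG' hGG' _ he⟩
      obtain ⟨e, he⟩ := this
      exact ⟨_, G.map f.op he⟩
  have total' (n : SemiSimplexCategoryᵒᵖ) (x : C.toFunctor.obj n) :
      ∃ e, (x.1, e) ∈ G.obj n := total _ x.1 x.2 rfl
  choose l hl using total'
  exact ⟨⟨{
    l :=
      { app := fun n ↦ ↾(l n)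
        naturality := by
          intro n m f
          ext x
          exact hG.prop.unique (hl m _) (G.map f (hl n x)) }
    fac_left := by
      ext n x
      exact hG.prop.unique (hl n _) (hle _ ⟨x.2, rfl⟩)
    fac_right := by
      ext n x
      exact (hG.prop.comm (hl n x)).choose_spec }⟩⟩

end Pairing

end SemiSSet

/-! ### Collapsed intervals of simplices -/

namespace SSet

/-- The map `[n] → [n]` sending the interval `[i, j]` to `i` and fixing everything else. -/
def collapseHom {n : SimplexCategory} (i j : Fin (n.len + 1)) : n ⟶ n :=
  SimplexCategory.Hom.mk
    { toFun := fun x ↦ if i ≤ x ∧ x ≤ j then i else x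
      monotone' := by
        intro x y hxy
        dsimp only
        split_ifs <;> omega }

lemma collapseHom_apply {n : SimplexCategory} (i j x : Fin (n.len + 1)) :
    (collapseHom i j).toOrderHom x = if i ≤ x ∧ x ≤ j then i else x := rfl

/-- An `n`-simplex collapses the interval `[i, j]` if it is degenerate along it, i.e. if it is the
restriction of a simplex along a map that is constant on `[i, j]`. -/
def Collapses {K : SSet.{u}} {n : SimplexCategory} (s : K.obj (op n)) (i j : Fin (n.len + 1)) :
    Prop :=
  K.map (collapseHom i j).op s = s

section

variable {K : SSet.{u}} {m n : SimplexCategory}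

lemma collapses_map_of_eq (g : m ⟶ n) (t : K.obj (op n)) {i j : Fin (m.len + 1)}
    (h : g.toOrderHom i = g.toOrderHom j) : Collapses (K.map g.op t) i j := by
  have hg : collapseHom i j ≫ g = g := by
    ext x : 3
    change g.toOrderHom ((collapseHom i j).toOrderHom x) = g.toOrderHom x
    rw [collapseHom_apply]
    split_ifs with hx
    · exact le_antisymm (g.toOrderHom.monotone hx.1) (h ▸ g.toOrderHom.monotone hx.2)
    · rfl
  unfold Collapses
  conv_rhs => rw [← hg]
  simp

lemma Collapses.of_map_eq {s : K.obj (op n)} (g : n ⟶ n) (hs : K.map g.op s = s)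
    {i j : Fin (n.len + 1)} (h : g.toOrderHom i = g.toOrderHom j) : Collapses s i j := by
  rw [← hs]
  exact collapses_map_of_eq g s h

lemma Collapses.map {s : K.obj (op n)} (f : m ⟶ n) {i j : Fin (m.len + 1)} (hij : i ≤ j)
    (h : Collapses s (f.toOrderHom i) (f.toOrderHom j)) : Collapses (K.map f.op s) i j := by
  have h1 : K.map f.op s = K.map (f ≫ collapseHom (f.toOrderHom i) (f.toOrderHom j)).op s := by
    conv_lhs => rw [← h]
    simp
  rw [h1]
  apply collapses_map_of_eq
  change (collapseHom _ _).toOrderHom (f.toOrderHom i) =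
    (collapseHom _ _).toOrderHom (f.toOrderHom j)
  have := f.toOrderHom.monotone hij
  simp [collapseHom_apply, this]

lemma Collapses.mono {s : K.obj (op n)} {i j i' j' : Fin (n.len + 1)} (h : Collapses s i j)
    (hi : i ≤ i') (hij : i' ≤ j') (hj : j' ≤ j) : Collapses s i' j' := by
  refine .of_map_eq _ h ?_
  rw [collapseHom_apply, collapseHom_apply, if_pos ⟨hi, hij.trans hj⟩, if_pos ⟨hi.trans hij, hj⟩]

lemma Collapses.trans {s : K.obj (op n)} {i j l : Fin (n.len + 1)} (h : Collapses s i j)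
    (h' : Collapses s j l) (hij : i ≤ j) (hjl : j ≤ l) : Collapses s i l := by
  refine .of_map_eq (collapseHom j l ≫ collapseHom i j) ?_ ?_
  · have : K.map (collapseHom j l ≫ collapseHom i j).op s =
        K.map (collapseHom j l).op (K.map (collapseHom i j).op s) := by simp
    rw [this, h, h']
  · change (collapseHom _ _).toOrderHom ((collapseHom _ _).toOrderHom i) =
      (collapseHom _ _).toOrderHom ((collapseHom _ _).toOrderHom l)
    simp only [collapseHom_apply]
    split_ifs <;> first | rfl | omega

end

/-- A simplicial set reflects collapses if the face of a simplex along an injection `f` collapses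
`[i, j]` only if the simplex itself collapses `[f i, f j]`. This holds when all faces of
nondegenerate simplices are nondegenerate, as in a free simplicial set. -/
def ReflectsCollapses (K : SSet.{u}) : Prop :=
  ∀ ⦃m n : SimplexCategory⦄ (f : m ⟶ n), Function.Injective f.toOrderHom →
    ∀ (s : K.obj (op n)) ⦃i j : Fin (m.len + 1)⦄, i < j →
      Collapses (K.map f.op s) i j → Collapses s (f.toOrderHom i) (f.toOrderHom j)

end SSet

namespace SemiSSet

open SemiSimplexCategory SSet

lemma toSimplexCategory_map_injective {m n : SemiSimplexCategory} (f : m ⟶ n) :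
    Function.Injective (toSimplexCategory.map f).toOrderHom :=
  (homEquiv f).injective

/-- The simplices of `K` that do not collapse any interval. -/
def noncollapsing (K : SSet.{u}) (hK : ReflectsCollapses K) : Subfunctor (forget K) where
  obj n := Set.ofPred (fun s : K.obj (op (toSimplexCategory.obj n.unop)) ↦
    ∀ i j : Fin (n.unop.len + 1), i < j → ¬ Collapses s i j)
  map f s hs _ _ hij h :=
    hs _ _ ((homEquiv f.unop).strictMono hij)
      (hK _ (toSimplexCategory_map_injective f.unop) s hij h)

/-- The underlying subobject `U J ⊆ U K` of a subcomplex `J ⊆ K`. -/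
def forgetSubcomplex {K : SSet.{u}} (J : K.Subcomplex) : Subfunctor (forget K) where
  obj n := J.obj (op (toSimplexCategory.obj n.unop))
  map f := J.map (toSimplexCategory.op.map f)

/-- The semisimplicial set whose `n`-simplices are the monotone maps `[n] → {false < true}`. -/
def cuts : SemiSSet.{u} where
  obj n := ULift.{u} (Fin (n.unop.len + 1) →o Bool)
  map f := ↾fun c ↦ ⟨c.down.comp (homEquiv f.unop).toOrderHom⟩

/-! ### The pairing on the partially degenerate cylinder -/

section Cylinder

variable {K : SSet.{u}} (hK : ReflectsCollapses K) (J : K.Subcomplex)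

/-- The cylinder on `U K` consisting of the simplices `(s, c)` of `K × Δ¹` such that `s` is
nondegenerate over the end `true`. -/
def cylinder : Subfunctor (cartesianProduct (forget K) cuts.{u}) where
  obj n := Set.ofPred (fun z : K.obj (op (toSimplexCategory.obj n.unop)) ×
      ULift.{u} (Fin (n.unop.len + 1) →o Bool) ↦
    ∀ i j, i < j → z.2.down i = true → ¬ Collapses z.1 i j)
  map f z hz _ _ hij hi h :=
    hz _ _ ((homEquiv f.unop).strictMono hij) hi
      (hK _ (toSimplexCategory_map_injective f.unop) z.1 hij h)

/-- The part of the cylinder that lies over `J` or is a nondegenerate simplex of the end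
`false`. -/
def cylinderBase : Subfunctor (cartesianProduct (forget K) cuts.{u}) where
  obj n := Set.ofPred (fun z : K.obj (op (toSimplexCategory.obj n.unop)) ×
      ULift.{u} (Fin (n.unop.len + 1) →o Bool) ↦
    (∀ i j, i < j → z.2.down i = true → ¬ Collapses z.1 i j) ∧
      (z.1 ∈ J.obj _ ∨
        ((∀ i, z.2.down i = false) ∧ ∀ i j, i < j → ¬ Collapses z.1 i j)))
  map f _ hz :=
    ⟨(cylinder hK).map f hz.1, hz.2.imp (fun h ↦ J.map _ h) (fun h ↦
      ⟨fun _ ↦ h.1 _, (noncollapsing K hK).map f h.2⟩)⟩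

lemma cylinderBase_le : cylinderBase hK J ≤ cylinder hK := fun _ _ h ↦ h.1

section Combinatorics

variable {n : ℕ} {hK} {J}

/-- An interval that contains vertices on both sides of the cut `c` is collapsed. -/
def CollapsesAcross (s : K.obj (op ⦋n⦌)) (c : Fin (n + 1) →o Bool) : Prop :=
  ∃ i j : Fin (n + 1), i < j ∧ c i = false ∧ c j = true ∧ Collapses s i j

/-- An interval on the `false` side of the cut `c` is collapsed. -/
def CollapsesBefore (s : K.obj (op ⦋n⦌)) (c : Fin (n + 1) →o Bool) : Prop :=
  ∃ i j : Fin (n + 1), i < j ∧ c j = false ∧ Collapses s i j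

/-- The `k`-th face of a cut. -/
def cutFace (c : Fin (n + 1 + 1) →o Bool) (k : Fin (n + 2)) : Fin (n + 1) →o Bool :=
  c.comp (Fin.succAboveOrderEmb k).toOrderHom

lemma cutFace_apply (c : Fin (n + 1 + 1) →o Bool) (k : Fin (n + 2)) (i : Fin (n + 1)) :
    cutFace c k i = c (k.succAbove i) := rfl

lemma collapses_δ_iff (hK : ReflectsCollapses K) (s : K.obj (op ⦋n + 1⦌)) (k : Fin (n + 2))
    {i j : Fin (n + 1)} (hij : i < j) :
    Collapses (K.map (SimplexCategory.δ k).op s) i j ↔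
      Collapses s (k.succAbove i) (k.succAbove j) :=
  ⟨fun h ↦ hK (SimplexCategory.δ k) (Fin.succAbove_right_injective (p := k)) s hij h,
    fun h ↦ Collapses.map (SimplexCategory.δ k) hij.le h⟩

lemma exists_cut (c : Fin (n + 2) →o Bool) {i j : Fin (n + 2)} (hi : c i = false)
    (hj : c j = true) : ∃ a : Fin (n + 1), c a.castSucc = false ∧ c a.succ = true := by
  by_contra! h
  have : ∀ x : Fin (n + 2), i ≤ x → c x = false := by
    intro x
    induction x using Fin.induction with
    | zero =>
      intro hx
      obtain rfl : i = 0 := Fin.le_zero_iff.1 hx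
      exact hi
    | succ x ih =>
      intro hx
      obtain hx | rfl := hx.lt_or_eq
      · simpa using h x (ih (Fin.le_castSucc_iff.2 hx))
      · exact hi
  have hij : i ≤ j := by
    by_contra! hij
    have := c.monotone hij.le
    rw [hi, hj] at this
    exact absurd this (by decide)
  rw [this j hij] at hj
  exact absurd hj (by decide)

lemma cut_eq_true_iff (c : Fin (n + 2) →o Bool) {a : Fin (n + 1)} (h₀ : c a.castSucc = false)
    (h₁ : c a.succ = true) (x : Fin (n + 2)) : c x = true ↔ a.castSucc < x := by
  constructor
  · intro hx
    by_contra! h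
    have := c.monotone h
    rw [h₀, hx] at this
    exact absurd this (by decide)
  · intro hx
    have := c.monotone (Fin.castSucc_lt_iff_succ_le.1 hx)
    rw [h₁] at this
    exact le_antisymm le_top this

lemma cut_eq_false_iff (c : Fin (n + 2) →o Bool) {a : Fin (n + 1)} (h₀ : c a.castSucc = false)
    (h₁ : c a.succ = true) (x : Fin (n + 2)) : c x = false ↔ x ≤ a.castSucc := by
  rw [← not_lt, ← cut_eq_true_iff c h₀ h₁, Bool.not_eq_true]

/-- The cut `c` lies between `a` and `a + 1`, and `s` collapses the edge across it. -/
structure CutAt (s : K.obj (op ⦋n + 1⦌)) (c : Fin (n + 1 + 1) →o Bool) (a : Fin (n + 1)) :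
    Prop where
  left : c a.castSucc = false
  right : c a.succ = true
  collapses : Collapses s a.castSucc a.succ

lemma CollapsesAcross.exists_cutAt {s : K.obj (op ⦋n + 1⦌)} {c : Fin (n + 1 + 1) →o Bool}
    (h : CollapsesAcross s c) : ∃ a, CutAt s c a := by
  obtain ⟨i, j, hij, hi, hj, h⟩ := h
  obtain ⟨a, h₀, h₁⟩ := exists_cut c hi hj
  refine ⟨a, h₀, h₁, h.mono ((cut_eq_false_iff c h₀ h₁ i).1 hi) (Fin.castSucc_lt_succ).le
    (Fin.castSucc_lt_iff_succ_le.1 ((cut_eq_true_iff c h₀ h₁ j).1 hj))⟩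

lemma CutAt.collapsesAcross {s : K.obj (op ⦋n + 1⦌)} {c : Fin (n + 1 + 1) →o Bool}
    {a : Fin (n + 1)} (h : CutAt s c a) : CollapsesAcross s c :=
  ⟨_, _, Fin.castSucc_lt_succ, h.left, h.right, h.collapses⟩

open Classical in
/-- The index of the face with which a simplex that collapses the edge across the cut is paired.
It is one of the ends of that edge, so that the face determines the simplex: the end after the cut
if an interval before the cut is collapsed, and the end before it otherwise. -/
noncomputable def pairIndex (s : K.obj (op ⦋n + 1⦌)) (c : Fin (n + 1 + 1) →o Bool)
    (a : Fin (n + 1)) : Fin (n + 2) :=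
  if CollapsesBefore s c then a.succ else a.castSucc

lemma pairIndex_of_not_collapsesBefore {s : K.obj (op ⦋n + 1⦌)} {c : Fin (n + 1 + 1) →o Bool}
    (h : ¬ CollapsesBefore s c) (a : Fin (n + 1)) : pairIndex s c a = a.castSucc := if_neg h

lemma pairIndex_eq_or (s : K.obj (op ⦋n + 1⦌)) (c : Fin (n + 1 + 1) →o Bool) (a : Fin (n + 1)) :
    pairIndex s c a = a.castSucc ∨ pairIndex s c a = a.succ := by
  unfold pairIndex
  split_ifs <;> simp

lemma castSucc_lt_succ_succAbove_iff (a x : Fin (n + 1)) :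
    a.castSucc < a.succ.succAbove x ↔ a < x := by
  simp only [Fin.succAbove]
  split_ifs with h
  · exact Iff.rfl
  · simp only [Fin.lt_def, Fin.val_castSucc, Fin.val_succ] at h ⊢
    omega

lemma castSucc_lt_castSucc_succAbove_iff (a x : Fin (n + 1)) :
    a.castSucc < a.castSucc.succAbove x ↔ a ≤ x := by
  simp only [Fin.succAbove]
  split_ifs with h <;>
    (simp only [Fin.lt_def, Fin.le_def, Fin.val_castSucc, Fin.val_succ] at h ⊢; omega)

lemma succAbove_predAbove_eq_or {a : Fin (n + 1)} {k : Fin (n + 2)}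
    (hk : k = a.castSucc ∨ k = a.succ) (x : Fin (n + 2)) :
    k.succAbove (a.predAbove x) = x ∨
      (a.castSucc ≤ k.succAbove (a.predAbove x) ∧ k.succAbove (a.predAbove x) ≤ a.succ ∧
        a.castSucc ≤ x ∧ x ≤ a.succ) := by
  have hp : (a.predAbove x).val = if a.val < x.val then x.val - 1 else x.val := by
    simp only [Fin.predAbove, Fin.lt_def, Fin.val_castSucc]
    split_ifs <;> rfl
  have hs : (k.succAbove (a.predAbove x)).val =
      if (a.predAbove x).val < k.val then (a.predAbove x).val else (a.predAbove x).val + 1 := by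
    simp only [Fin.succAbove, Fin.lt_def, Fin.val_castSucc]
    split_ifs <;> rfl
  have hk' : k.val = a.val ∨ k.val = a.val + 1 := hk.imp (by rintro rfl; rfl) (by rintro rfl; rfl)
  simp only [Fin.ext_iff, Fin.le_def, Fin.val_castSucc, Fin.val_succ]
  rw [hp] at hs
  split_ifs at hs <;> omega

variable {s : K.obj (op ⦋n + 1⦌)} {c : Fin (n + 1 + 1) →o Bool} {a : Fin (n + 1)}

/-- A simplex that collapses an edge is recovered from either face opposite to an end of it. -/
lemma σ_δ_of_cutAt (h : Collapses s a.castSucc a.succ) {k : Fin (n + 2)}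
    (hk : k = a.castSucc ∨ k = a.succ) :
    K.map (SimplexCategory.σ a).op (K.map (SimplexCategory.δ k).op s) = s := by
  have h1 : SimplexCategory.σ a ≫ SimplexCategory.δ k ≫
      collapseHom (n := ⦋n + 1⦌) a.castSucc a.succ =
        collapseHom (n := ⦋n + 1⦌) a.castSucc a.succ := by
    ext x : 3
    change (collapseHom (n := ⦋n + 1⦌) a.castSucc a.succ).toOrderHom (k.succAbove (a.predAbove x)) =
      (collapseHom (n := ⦋n + 1⦌) a.castSucc a.succ).toOrderHom x
    have hx : k.succAbove (a.predAbove x) = x ∨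
        (a.castSucc ≤ k.succAbove (a.predAbove x) ∧ k.succAbove (a.predAbove x) ≤ a.succ ∧
          a.castSucc ≤ x ∧ x ≤ a.succ) := by
      exact succAbove_predAbove_eq_or hk x
    obtain hx | ⟨h₁, h₂, h₃, h₄⟩ := hx
    · rw [hx]
    · rw [collapseHom_apply, collapseHom_apply, if_pos ⟨h₁, h₂⟩, if_pos ⟨h₃, h₄⟩]
  have h2 : K.map (SimplexCategory.σ a).op (K.map (SimplexCategory.δ k).op s) =
      K.map (SimplexCategory.σ a ≫ SimplexCategory.δ k ≫
        collapseHom (n := ⦋n + 1⦌) a.castSucc a.succ).op s := by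
    conv_lhs => rw [← h]
    simp
  rw [h2, h1, h]

lemma collapsesBefore_face_iff (hK : ReflectsCollapses K) (h : CutAt s c a) :
    CollapsesBefore (K.map (SimplexCategory.δ (pairIndex s c a)).op s)
      (cutFace c (pairIndex s c a)) ↔ CollapsesBefore s c := by
  constructor
  · rintro ⟨i, j, hij, hj, hc⟩
    exact ⟨_, _, (Fin.strictMono_succAbove _) hij, hj, (collapses_δ_iff hK s _ hij).1 hc⟩
  · intro hB
    rw [pairIndex, if_pos hB]
    obtain ⟨i, j, hij, hj, hc⟩ := hB
    have hj' := (cut_eq_false_iff c h.left h.right j).1 hj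
    have hja : j < a.succ := hj'.trans_lt Fin.castSucc_lt_succ
    obtain ⟨i, rfl⟩ := Fin.exists_succAbove_eq (hij.trans hja).ne
    obtain ⟨j, rfl⟩ := Fin.exists_succAbove_eq hja.ne
    have hij' := (Fin.strictMono_succAbove _).lt_iff_lt.1 hij
    exact ⟨i, j, hij', hj, (collapses_δ_iff hK s _ hij').2 hc⟩

lemma not_collapsesAcross_face (hK : ReflectsCollapses K) (h : CutAt s c a)
    (hs : ∀ i j : Fin (n + 2), i < j → c i = true → ¬ Collapses s i j) :
    ¬ CollapsesAcross (K.map (SimplexCategory.δ (pairIndex s c a)).op s)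
      (cutFace c (pairIndex s c a)) := by
  rintro ⟨i, j, hij, hi, hj, hc⟩
  rw [cutFace_apply] at hi hj
  rw [collapses_δ_iff hK s _ hij] at hc
  have hi' := (cut_eq_false_iff c h.left h.right _).1 hi
  have hj' := (cut_eq_true_iff c h.left h.right _).1 hj
  have hne := Fin.succAbove_ne (pairIndex s c a)
  by_cases hB : CollapsesBefore s c
  · have hk : pairIndex s c a = a.succ := if_pos hB
    have hja := lt_of_le_of_ne (Fin.castSucc_lt_iff_succ_le.1 hj') (hk ▸ (hne j).symm)
    exact hs _ _ hja h.right (hc.mono (hi'.trans Fin.castSucc_lt_succ.le) hja.le le_rfl)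
  · have hk : pairIndex s c a = a.castSucc := if_neg hB
    have hia := lt_of_le_of_ne hi' (hk ▸ hne i)
    exact hB ⟨_, _, hia, h.left, hc.mono le_rfl hia.le hj'.le⟩

lemma card_cut_face (b : Bool) (k : Fin (n + 2)) :
    (Finset.univ.filter (fun j ↦ c j = b)).card =
      (if c k = b then 1 else 0) + (Finset.univ.filter (fun i ↦ cutFace c k i = b)).card := by
  simp only [Finset.card_filter]
  exact Fin.sum_univ_succAbove _ k

open Classical in
/-- The order in which simplices are attached. A simplex that collapses an interval across the cut
and the face paired with it have the same rank. The first component is the dimension of the former;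
the second counts the vertices on the side of the cut that loses no vertex in passing to the paired
face. -/
noncomputable def cylinderRank {n : ℕ} (s : K.obj (op ⦋n⦌)) (c : Fin (n + 1) →o Bool) : ℕ ×ₗ ℕ :=
  toLex (if CollapsesAcross s c then n else n + 1,
    if CollapsesBefore s c then (Finset.univ.filter (fun j ↦ c j = false)).card
      else (Finset.univ.filter (fun j ↦ c j = true)).card)

lemma cylinderRank_lt_of_lt {m : ℕ} (t : K.obj (op ⦋m⦌)) (d : Fin (m + 1) →o Bool) (hm : m < n)
    (h : CutAt s c a) : cylinderRank t d < cylinderRank s c := by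
  rw [cylinderRank, cylinderRank, Prod.Lex.toLex_lt_toLex, if_pos h.collapsesAcross]
  left
  dsimp only
  split_ifs <;> omega

lemma cylinderRank_face (hK : ReflectsCollapses K) (h : CutAt s c a)
    (hs : ∀ i j : Fin (n + 2), i < j → c i = true → ¬ Collapses s i j) :
    cylinderRank (K.map (SimplexCategory.δ (pairIndex s c a)).op s)
      (cutFace c (pairIndex s c a)) = cylinderRank s c := by
  simp only [cylinderRank, if_neg (not_collapsesAcross_face hK h hs), if_pos h.collapsesAcross]
  congr 2
  by_cases hB : CollapsesBefore s c
  · rw [if_pos ((collapsesBefore_face_iff hK h).2 hB), if_pos hB,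
      card_cut_face (c := c) false (pairIndex s c a), pairIndex, if_pos hB, h.right]
    simp
  · rw [if_neg (fun h' ↦ hB ((collapsesBefore_face_iff hK h).1 h')), if_neg hB,
      card_cut_face (c := c) true (pairIndex s c a), pairIndex, if_neg hB, h.left]
    simp

/-- A face other than the paired one has smaller rank: either it still collapses an interval across
the cut, in lower dimension, or it omits the other end of the collapsed edge, which lies on the side
whose vertices are counted. -/
lemma cylinderRank_face_lt (hK : ReflectsCollapses K) (h : CutAt s c a) {k : Fin (n + 2)}
    (hk : k ≠ pairIndex s c a) :
    cylinderRank (K.map (SimplexCategory.δ k).op s) (cutFace c k) < cylinderRank s c := by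
  rw [cylinderRank, cylinderRank, Prod.Lex.toLex_lt_toLex, if_pos h.collapsesAcross]
  by_cases hA : CollapsesAcross (K.map (SimplexCategory.δ k).op s) (cutFace c k)
  · left
    rw [if_pos hA]
    exact Nat.lt_succ_self n
  right
  refine ⟨by rw [if_neg hA], ?_⟩
  have across {i j : Fin (n + 2)} (hij : i < j) (hi : c i = false) (hj : c j = true)
      (hc : Collapses s i j) : i = k ∨ j = k := by
    by_contra! hne
    obtain ⟨i, rfl⟩ := Fin.exists_succAbove_eq hne.1
    obtain ⟨j, rfl⟩ := Fin.exists_succAbove_eq hne.2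
    have hij' := (Fin.strictMono_succAbove _).lt_iff_lt.1 hij
    exact hA ⟨i, j, hij', hi, hj, (collapses_δ_iff hK s _ hij').2 hc⟩
  have hka := across Fin.castSucc_lt_succ h.left h.right h.collapses
  by_cases hB : CollapsesBefore s c
  · obtain rfl : a.castSucc = k := hka.resolve_right (fun h ↦ hk (by rw [pairIndex, if_pos hB, h]))
    have hB' : CollapsesBefore (K.map (SimplexCategory.δ a.castSucc).op s)
        (cutFace c a.castSucc) := by
      obtain ⟨i, j, hij, hj, hc⟩ := hB
      have hja : j < a.castSucc := by
        refine lt_of_le_of_ne ((cut_eq_false_iff c h.left h.right j).1 hj) ?_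
        rintro rfl
        have hia : i < a.succ := hij.trans Fin.castSucc_lt_succ
        have hi : c i = false := (cut_eq_false_iff c h.left h.right i).2 hij.le
        obtain rfl | h' := across hia hi h.right
          (hc.trans h.collapses hij.le Fin.castSucc_lt_succ.le)
        · exact lt_irrefl _ hij
        · exact Fin.castSucc_lt_succ.ne' h'
      obtain ⟨i, rfl⟩ := Fin.exists_succAbove_eq (hij.trans hja).ne
      obtain ⟨j, rfl⟩ := Fin.exists_succAbove_eq hja.ne
      have hij' := (Fin.strictMono_succAbove _).lt_iff_lt.1 hij
      exact ⟨i, j, hij', hj, (collapses_δ_iff hK s _ hij').2 hc⟩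
    dsimp only
    rw [if_pos hB, if_pos hB', card_cut_face (c := c) false a.castSucc, if_pos h.left]
    omega
  · obtain rfl : a.succ = k := hka.resolve_left (fun h ↦ hk (by rw [pairIndex, if_neg hB, h]))
    have hB' : ¬ CollapsesBefore (K.map (SimplexCategory.δ a.succ).op s)
        (cutFace c a.succ) := by
      rintro ⟨i, j, hij, hj, hc⟩
      exact hB ⟨_, _, (Fin.strictMono_succAbove _) hij, hj, (collapses_δ_iff hK s _ hij).1 hc⟩
    dsimp only
    rw [if_neg hB, if_neg hB', card_cut_face (c := c) true a.succ, if_pos h.right]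
    omega

/-- A simplex of the cylinder is determined by the face with which it is paired. -/
lemma eq_of_face_eq (hK : ReflectsCollapses K) (h : CutAt s c a) {s' : K.obj (op ⦋n + 1⦌)}
    {c' : Fin (n + 1 + 1) →o Bool} {a' : Fin (n + 1)} (h' : CutAt s' c' a')
    (hs : K.map (SimplexCategory.δ (pairIndex s c a)).op s =
      K.map (SimplexCategory.δ (pairIndex s' c' a')).op s')
    (hc : cutFace c (pairIndex s c a) = cutFace c' (pairIndex s' c' a')) :
    s = s' ∧ c = c' := by
  have hB : CollapsesBefore s c ↔ CollapsesBefore s' c' := by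
    rw [← collapsesBefore_face_iff hK h, hs, hc, collapsesBefore_face_iff hK h']
  have hc' (x : Fin (n + 1)) : a.castSucc < (pairIndex s c a).succAbove x ↔
      a'.castSucc < (pairIndex s' c' a').succAbove x := by
    rw [← cut_eq_true_iff c h.left h.right, ← cut_eq_true_iff c' h'.left h'.right,
      ← cutFace_apply, ← cutFace_apply, hc]
  obtain rfl : a = a' := by
    by_cases hB' : CollapsesBefore s' c'
    · simp only [pairIndex, if_pos hB', if_pos (hB.2 hB'), castSucc_lt_succ_succAbove_iff] at hc'
      exact le_antisymm (not_lt.1 fun h₀ ↦ lt_irrefl _ ((hc' a).2 h₀))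
        (not_lt.1 fun h₀ ↦ lt_irrefl _ ((hc' a').1 h₀))
    · simp only [pairIndex, if_neg hB', if_neg (fun h ↦ hB' (hB.1 h)),
        castSucc_lt_castSucc_succAbove_iff] at hc'
      exact le_antisymm ((hc' a').2 le_rfl) ((hc' a).1 le_rfl)
  constructor
  · rw [← σ_δ_of_cutAt h.collapses (pairIndex_eq_or s c a), hs,
      σ_δ_of_cutAt h'.collapses (pairIndex_eq_or s' c' a)]
  · ext x
    rw [Bool.eq_iff_iff, cut_eq_true_iff c h.left h.right, cut_eq_true_iff c' h'.left h'.right]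

/-- The cut of `[n + 1]` after `a`. -/
def cutAfter (a : Fin (n + 1)) : Fin (n + 1 + 1) →o Bool where
  toFun x := decide (a.castSucc < x)
  monotone' x y hxy := by
    by_cases h : a.castSucc < x
    · simp [h, h.trans_le hxy]
    · simp [h]

lemma cutAfter_apply (a : Fin (n + 1)) (x : Fin (n + 2)) :
    cutAfter a x = decide (a.castSucc < x) := rfl

lemma cutAt_σ (t : K.obj (op ⦋n⦌)) (a : Fin (n + 1)) :
    CutAt (K.map (SimplexCategory.σ a).op t) (cutAfter a) a where
  left := by simp [cutAfter_apply]
  right := by simp [cutAfter_apply]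
  collapses := by
    apply collapses_map_of_eq
    change a.predAbove a.castSucc = a.predAbove a.succ
    simp

lemma δ_σ (t : K.obj (op ⦋n⦌)) (a : Fin (n + 1)) {k : Fin (n + 2)}
    (hk : k = a.castSucc ∨ k = a.succ) :
    K.map (SimplexCategory.δ k).op (K.map (SimplexCategory.σ a).op t) = t := by
  have : K.map (SimplexCategory.δ k).op (K.map (SimplexCategory.σ a).op t) =
      K.map (SimplexCategory.δ k ≫ SimplexCategory.σ a).op t := by simp
  rw [this]
  obtain rfl | rfl := hk
  · rw [SimplexCategory.δ_comp_σ_self]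
    simp
  · rw [SimplexCategory.δ_comp_σ_succ]
    simp

/-- A simplex of the cylinder, not in the base, that does not collapse an edge across the cut is
the face paired with a simplex that does. The latter repeats the last vertex before the cut on the
other side if the former collapses an interval before the cut, and the first vertex after the cut
otherwise. -/
lemma exists_cutAt_of_not_collapsesAcross (hK : ReflectsCollapses K) {n : ℕ}
    {t : K.obj (op ⦋n⦌)} {d : Fin (n + 1) →o Bool}
    (ht : ∀ i j : Fin (n + 1), i < j → d i = true → ¬ Collapses t i j)
    (hA : ¬ CollapsesAcross t d)
    (hbase : CollapsesBefore t d ∨ ∃ i, d i = true) :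
    ∃ (s : K.obj (op ⦋n + 1⦌)) (c : Fin (n + 1 + 1) →o Bool) (a : Fin (n + 1)),
      CutAt s c a ∧ (∀ i j : Fin (n + 2), i < j → c i = true → ¬ Collapses s i j) ∧
      K.map (SimplexCategory.δ (pairIndex s c a)).op s = t ∧
      cutFace c (pairIndex s c a) = d := by
  have aux (a : Fin (n + 1)) (hlt : ∀ x, a < x → d x = true) (hgt : ∀ x, x < a → d x = false) :
      ∀ i j : Fin (n + 2), i < j → cutAfter a i = true →
        ¬ Collapses (K.map (SimplexCategory.σ a).op t) i j := by
    intro i j hij hi hc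
    have hi' : a.castSucc < i := by simpa [cutAfter_apply] using hi
    obtain ⟨i, rfl⟩ := Fin.exists_succAbove_eq hi'.ne'
    obtain ⟨j, rfl⟩ := Fin.exists_succAbove_eq (hi'.trans hij).ne'
    have hij' := (Fin.strictMono_succAbove _).lt_iff_lt.1 hij
    have hc' := (collapses_δ_iff hK _ _ hij').2 hc
    rw [δ_σ t a (Or.inl rfl)] at hc'
    have hai : a ≤ i := (castSucc_lt_castSucc_succAbove_iff a i).1 hi'
    by_cases hdi : d i = true
    · exact ht i j hij' hdi hc'
    · exact hA ⟨i, j, hij', by simpa using hdi, hlt j (hai.trans_lt hij'), hc'⟩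
  by_cases hB : CollapsesBefore t d
  · obtain ⟨a, had, hmax⟩ : ∃ a, d a = false ∧ ∀ x, a < x → d x = true := by
      obtain ⟨i, j, -, hj, -⟩ := hB
      have hne : (Finset.univ.filter (fun x ↦ d x = false)).Nonempty := ⟨j, by simpa using hj⟩
      refine ⟨Finset.max' _ hne, by simpa using Finset.max'_mem _ hne, fun x hx ↦ ?_⟩
      by_contra hdx
      exact hx.not_ge (Finset.le_max' _ _ (by simpa using hdx))
    have hle : ∀ x, x ≤ a → d x = false := fun x hx ↦ by
      have := d.monotone hx
      rw [had] at this
      exact le_bot_iff.1 this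
    have hk : pairIndex (K.map (SimplexCategory.σ a).op t) (cutAfter a) a = a.succ := by
      refine if_pos ?_
      obtain ⟨i, j, hij, hj, hc⟩ := hB
      have hja : j ≤ a := by
        by_contra! h
        simp [hmax j h] at hj
      refine ⟨a.succ.succAbove i, a.succ.succAbove j, (Fin.strictMono_succAbove _) hij, ?_, ?_⟩
      · rw [cutAfter_apply, decide_eq_false_iff_not, castSucc_lt_succ_succAbove_iff]
        exact hja.not_gt
      · rw [← collapses_δ_iff hK _ _ hij, δ_σ t a (Or.inr rfl)]
        exact hc
    refine ⟨_, _, a, cutAt_σ t a, aux a hmax (fun x hx ↦ hle x hx.le), ?_, ?_⟩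
    · rw [hk, δ_σ t a (Or.inr rfl)]
    · rw [hk]
      ext x
      rw [cutFace_apply, cutAfter_apply, Bool.eq_iff_iff, decide_eq_true_iff,
        castSucc_lt_succ_succAbove_iff]
      obtain hx | hx := le_or_gt x a
      · simp [hle x hx, hx]
      · simp [hmax x hx, hx]
  · obtain ⟨a, had, hmin⟩ : ∃ a, d a = true ∧ ∀ x, x < a → d x = false := by
      obtain ⟨i, hi⟩ := hbase.resolve_left hB
      have hne : (Finset.univ.filter (fun x ↦ d x = true)).Nonempty := ⟨i, by simpa using hi⟩
      refine ⟨Finset.min' _ hne, by simpa using Finset.min'_mem _ hne, fun x hx ↦ ?_⟩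
      by_contra hdx
      exact hx.not_ge (Finset.min'_le _ _ (by simpa using hdx))
    have hge : ∀ x, a ≤ x → d x = true := fun x hx ↦ by
      have := d.monotone hx
      rw [had] at this
      exact top_le_iff.1 this
    have hk : pairIndex (K.map (SimplexCategory.σ a).op t) (cutAfter a) a = a.castSucc := by
      refine if_neg ?_
      rintro ⟨i, j, hij, hj, hc⟩
      have hja : j ≤ a.castSucc := by simpa [cutAfter_apply] using hj
      have hja' : j < a.succ := hja.trans_lt Fin.castSucc_lt_succ
      obtain ⟨i, rfl⟩ := Fin.exists_succAbove_eq (hij.trans hja').ne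
      obtain ⟨j, rfl⟩ := Fin.exists_succAbove_eq hja'.ne
      have hij' := (Fin.strictMono_succAbove _).lt_iff_lt.1 hij
      rw [← collapses_δ_iff hK _ _ hij', δ_σ t a (Or.inr rfl)] at hc
      rw [Fin.succAbove_lt_iff_castSucc_lt] at hja'
      have hja₀ : j ≤ a := by simpa using hja'
      obtain hja₁ | rfl := hja₀.lt_or_eq
      · exact hB ⟨i, j, hij', hmin j hja₁, hc⟩
      · exact hA ⟨i, j, hij', hmin i hij', had, hc⟩
    refine ⟨_, _, a, cutAt_σ t a, aux a (fun x hx ↦ hge x hx.le) hmin, ?_, ?_⟩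
    · rw [hk, δ_σ t a (Or.inl rfl)]
    · rw [hk]
      ext x
      rw [cutFace_apply, cutAfter_apply, Bool.eq_iff_iff, decide_eq_true_iff,
        castSucc_lt_castSucc_succAbove_iff]
      obtain hx | hx := lt_or_ge x a
      · simp [hmin x hx, hx]
      · simp [hge x hx, hx]

end Combinatorics

end Cylinder

end SemiSSet

namespace SemiSSet

open SemiSimplexCategory SSet

variable {K : SSet.{u}} (hK : ReflectsCollapses K) (J : K.Subcomplex)

lemma exists_eq_coface {n : ℕ} (f : ⦋n⦌ₛ ⟶ ⦋n + 1⦌ₛ) : ∃ j, f = coface j := by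
  have : Mono (toSimplexCategory.map f) := inferInstance
  obtain ⟨j, hj⟩ := @SimplexCategory.eq_δ_of_mono n (toSimplexCategory.map f) this
  exact ⟨j, toSimplexCategory.map_injective hj⟩

/-- The pairing that exhibits the cylinder as built from its base by filling horns: a simplex that
collapses the edge across the cut is paired with one of its two faces opposite to the ends of that
edge. -/
noncomputable def cylinderPairing :
    HornPairing (cylinderBase hK J) (cylinder hK) (ℕ ×ₗ ℕ) where
  P n y k := y ∈ (cylinder hK).obj _ ∧ y.1 ∉ J.obj (op ⦋n + 1⦌) ∧
    ∃ a : Fin (n + 1), CutAt (K := K) y.1 y.2.down a ∧ k = pairIndex (K := K) y.1 y.2.down a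
  rank n z := cylinderRank (K := K) z.1 z.2.down
  mem n y k h := h.1
  face_notMem := by
    rintro n ⟨s, c⟩ _ ⟨hs, hJ, a, ha, rfl⟩ ⟨-, h⟩
    obtain h | h := h
    · apply hJ
      change K.map (SimplexCategory.δ _).op s ∈ _ at h
      have := J.map (SimplexCategory.σ a).op h
      rw [← σ_δ_of_cutAt ha.collapses (pairIndex_eq_or s c.down a)]
      exact this
    · by_cases hB : CollapsesBefore (K := K) s c.down
      · obtain ⟨i, j, hij, -, hc⟩ := (collapsesBefore_face_iff hK ha).2 hB
        exact h.2 i j hij hc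
      · obtain ⟨i, hi⟩ := Fin.exists_succAbove_eq
          (show a.succ ≠ pairIndex (K := K) s c.down a by
            rw [pairIndex_of_not_collapsesBefore hB]
            exact Fin.castSucc_lt_succ.ne')
        have h1 := h.1 i
        have h2 : c.down (a.succ) = false := hi ▸ h1
        rw [ha.right] at h2
        exact absurd h2 (by decide)
  cover := by
    rintro n ⟨s, c⟩ hx hx'
    by_cases hA : CollapsesAcross (K := K) s c.down
    · obtain ⟨m, rfl⟩ : ∃ m, n = m + 1 := by
        obtain ⟨i, j, hij, -⟩ := hA
        have : (i : ℕ) < j := hij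
        have := j.isLt
        dsimp at this
        exact ⟨n - 1, by omega⟩
      obtain ⟨a, ha⟩ := hA.exists_cutAt
      let y : (cartesianProduct (forget K) cuts.{u}).obj (op ⦋m + 1⦌ₛ) := (s, c)
      exact ⟨m, y, _, 𝟙 _, ⟨hx, fun h ↦ hx' ⟨hx, Or.inl h⟩, a, ha, rfl⟩,
        ConcreteCategory.congr_hom ((cartesianProduct (forget K) cuts).map_id _) y, le_rfl⟩
    · have hJ : s ∉ J.obj _ := fun h ↦ hx' ⟨hx, Or.inl h⟩
      have hbase : CollapsesBefore (K := K) s c.down ∨ ∃ i, c.down i = true := by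
        by_contra! h
        refine hx' ⟨hx, Or.inr ⟨fun i ↦ by simpa using h.2 i, fun i j hij hc ↦ ?_⟩⟩
        exact h.1 ⟨i, j, hij, by simpa using h.2 j, hc⟩
      obtain ⟨t, d, a, ha, ht, h₁, h₂⟩ :=
        exists_cutAt_of_not_collapsesAcross (K := K) hK hx hA hbase
      subst h₁
      refine ⟨n, (t, ⟨d⟩), _, coface (pairIndex t d a),
        ⟨ht, fun h ↦ hJ (J.map (SimplexCategory.δ _).op h), a, ha, rfl⟩,
        Prod.ext rfl (ULift.ext _ _ h₂), ?_⟩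
      rw [← cylinderRank_face hK ha ht, h₂]
  rank_lt := by
    rintro n ⟨s, c⟩ _ ⟨hs, hJ, a, ha, rfl⟩ m f hf
    right
    have hm : m ≤ n + 1 := by
      have := Fintype.card_le_of_injective _ (homEquiv f).injective
      simpa using this
    obtain hm | rfl | rfl : m < n ∨ m = n ∨ m = n + 1 := by omega
    · exact cylinderRank_lt_of_lt _ _ hm ha
    · obtain ⟨j, rfl⟩ : ∃ j, f = coface j := exists_eq_coface f
      refine cylinderRank_face_lt hK ha ?_
      rintro rfl
      apply hf
      rw [Set.eq_univ_iff_forall]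
      intro x
      by_cases hx : x = pairIndex (K := K) s c.down a
      · exact Or.inr hx
      · exact Or.inl (Fin.exists_succAbove_eq hx)
    · exfalso
      apply hf
      rw [(Finite.surjective_of_injective (homEquiv f).injective).range_eq]
      simp
  rank_face := by
    rintro n ⟨s, c⟩ _ ⟨hs, hJ, a, ha, rfl⟩
    exact cylinderRank_face hK ha hs
  face_inj := by
    rintro n ⟨s, c⟩ ⟨s', c'⟩ _ _ ⟨-, -, a, ha, rfl⟩ ⟨-, -, a', ha', rfl⟩ h
    obtain ⟨h₁, h₂⟩ := Prod.ext_iff.1 h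
    obtain ⟨rfl, h₃⟩ := eq_of_face_eq hK ha ha' h₁ (congrArg ULift.down h₂)
    exact Prod.ext rfl (ULift.ext _ _ h₃)
  face_ne := by
    rintro n ⟨s, c⟩ ⟨s', c'⟩ _ _ ⟨-, -, a, ha, rfl⟩ ⟨hs', -, a', ha', rfl⟩ h
    obtain ⟨h₁, h₂⟩ := Prod.ext_iff.1 h
    apply not_collapsesAcross_face hK ha' hs'
    have h₃ : cutFace c'.down (pairIndex (K := K) s' c'.down a') = c.down := congrArg ULift.down h₂
    have h₄ : K.map (SimplexCategory.δ (pairIndex (K := K) s' c'.down a')).op s' = s := h₁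
    rw [h₃, h₄]
    exact ha.collapsesAcross

lemma anodyne_cylinderBase : anodyne (Subfunctor.homOfLe (cylinderBase_le hK J)) :=
  (cylinderPairing hK J).anodyne _

/-- If `K` reflects collapses, the inclusion into `U K` of the nondegenerate simplices and the
simplices of a subcomplex `J` is anodyne: it is a retract of the inclusion of the base of the
cylinder. -/
theorem anodyne_noncollapsing_sup :
    anodyne (noncollapsing K hK ⊔ forgetSubcomplex J).ι := by
  let i₀ : forget K ⟶ (cylinder hK).toFunctor :=
    { app := fun n ↦ ↾fun s ↦ ⟨(s, ⟨OrderHom.const _ false⟩), fun _ _ _ h ↦ by simp at h⟩ }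
  let i₁ : (noncollapsing K hK ⊔ forgetSubcomplex J).toFunctor ⟶
      (cylinderBase hK J).toFunctor :=
    { app := fun n ↦ ↾fun s ↦ ⟨(s.1, ⟨OrderHom.const _ false⟩), fun _ _ _ h ↦ by simp at h,
        s.2.symm.imp id (fun h ↦ ⟨fun _ ↦ rfl, h⟩)⟩ }
  let r₀ : (cylinder hK).toFunctor ⟶ forget K :=
    { app := fun n ↦ ↾fun z ↦ z.1.1 }
  let r₁ : (cylinderBase hK J).toFunctor ⟶
      (noncollapsing K hK ⊔ forgetSubcomplex J).toFunctor :=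
    { app := fun n ↦ ↾fun z ↦ ⟨z.1.1, z.2.2.symm.imp (fun h ↦ h.2) id⟩ }
  have : RetractArrow (noncollapsing K hK ⊔ forgetSubcomplex J).ι
      (Subfunctor.homOfLe (cylinderBase_le hK J)) :=
    { i := Arrow.homMk i₁ i₀ rfl
      r := Arrow.homMk r₁ r₀ rfl
      retract := rfl }
  exact MorphismProperty.of_retract (P := fibrations.llp) this (anodyne_cylinderBase hK J)

end SemiSSet

/-! ### Anodyne maps from simplicial sets -/

namespace SSet

open MonoidalCategory

lemma ReflectsCollapses.tensor {K L : SSet.{u}} (hK : ReflectsCollapses K)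
    (hL : ReflectsCollapses L) : ReflectsCollapses (K ⊗ L) := by
  intro m n f hf s i j hij h
  obtain ⟨h1, h2⟩ := Prod.ext_iff.1 h
  exact Prod.ext (hK f hf s.1 hij h1) (hL f hf s.2 hij h2)

lemma collapses_stdSimplex_iff {d : ℕ} {n : SimplexCategory} (s : (Δ[d] : SSet.{u}).obj (op n))
    (i j : Fin (n.len + 1)) (hij : i ≤ j) :
    Collapses s i j ↔ stdSimplex.asOrderHom s i = stdSimplex.asOrderHom s j := by
  constructor
  · intro h
    have h1 (x) := DFunLike.congr_fun (congrArg stdSimplex.asOrderHom h) x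
    have h2 := (h1 i).symm.trans ((?_ : _ = _).trans (h1 j))
    · exact h2
    · change stdSimplex.asOrderHom s ((collapseHom i j).toOrderHom i) =
        stdSimplex.asOrderHom s ((collapseHom i j).toOrderHom j)
      rw [collapseHom_apply, collapseHom_apply, if_pos ⟨le_rfl, hij⟩, if_pos ⟨hij, le_rfl⟩]
  · intro h
    have h1 : (Δ[d] : SSet.{u}).map (stdSimplex.objEquiv s).op (stdSimplex.objEquiv.symm (𝟙 _)) = s
      := by
      apply stdSimplex.objEquiv.injective
      rw [stdSimplex.map_apply]
      simp
    rw [← h1]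
    exact collapses_map_of_eq _ _ h

lemma reflectsCollapses_stdSimplex (d : ℕ) : ReflectsCollapses (Δ[d] : SSet.{u}) := by
  intro m n f hf s i j hij h
  rw [collapses_stdSimplex_iff _ _ _ (f.toOrderHom.monotone hij.le)]
  exact (collapses_stdSimplex_iff _ _ _ hij.le).1 h

end SSet

namespace SemiSSet

open SemiSimplexCategory SSet MonoidalCategory

lemma anodyne.comp {A B C : SemiSSet.{u}} {f : A ⟶ B} {g : B ⟶ C} (hf : anodyne f)
    (hg : anodyne g) : anodyne (f ≫ g) :=
  MorphismProperty.comp_mem fibrations.llp f g hf hg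

lemma anodyne_of_isIso {A B : SemiSSet.{u}} (f : A ⟶ B) [IsIso f] : anodyne f :=
  MorphismProperty.of_isIso fibrations.llp f

namespace FreeSimplex

variable {A : SemiSSet.{u}} {n : SimplexCategory}

lemma restrict_proj_ofSimplex (s : FreeSimplex A n) :
    restrict s.proj (ofSimplex s.simplex) = s := by
  rw [restrict_eq s.proj (ofSimplex s.simplex) s.base s.proj s.epi (𝟙 s.base) (by simp [ofSimplex])]
  have h : A.map (𝟙 s.base).op s.simplex = s.simplex := by simp
  change (⟨s.base, s.proj, s.epi, A.map (𝟙 s.base).op s.simplex⟩ : FreeSimplex A n) = s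
  rw [h]

lemma proj_restrict_eq_iff {m : SimplexCategory} (f : m ⟶ n) (s : FreeSimplex A n)
    (i j : Fin (m.len + 1)) :
    (restrict f s).proj.toOrderHom i = (restrict f s).proj.toOrderHom j ↔
      s.proj.toOrderHom (f.toOrderHom i) = s.proj.toOrderHom (f.toOrderHom j) := by
  obtain ⟨a, ha, -⟩ := restrict_spec f s
  have h (x : Fin (m.len + 1)) : (toSimplexCategory.map a).toOrderHom
      ((restrict f s).proj.toOrderHom x) = s.proj.toOrderHom (f.toOrderHom x) :=
    SimplexCategory.congr_toOrderHom_apply ha x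
  rw [← h, ← h, (toSimplexCategory_map_injective a).eq_iff]

lemma collapses_iff (s : (free A).obj (op n)) {i j : Fin (n.len + 1)} (hij : i ≤ j) :
    Collapses s i j ↔
      (show FreeSimplex A n from s).proj.toOrderHom i =
        (show FreeSimplex A n from s).proj.toOrderHom j := by
  constructor
  · intro (h : restrict (collapseHom i j) s = s)
    have h1 := (proj_restrict_eq_iff (collapseHom i j) s i j).2 (by
      rw [collapseHom_apply, collapseHom_apply, if_pos ⟨le_rfl, hij⟩, if_pos ⟨hij, le_rfl⟩])
    rwa [h] at h1
  · intro h
    have h1 := collapses_map_of_eq (K := free A) _ (ofSimplex (FreeSimplex.simplex s)) h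
    exact (restrict_proj_ofSimplex s).symm ▸ h1

end FreeSimplex

lemma reflectsCollapses_free (A : SemiSSet.{u}) : ReflectsCollapses (free A) := by
  intro m n f hf s i j hij h
  rw [FreeSimplex.collapses_iff _ (f.toOrderHom.monotone hij.le)]
  exact (FreeSimplex.proj_restrict_eq_iff f s i j).1 ((FreeSimplex.collapses_iff _ hij.le).1 h)

/-- A levelwise injective map onto the noncollapsing simplices is anodyne. -/
lemma anodyne_of_range_eq {K : SSet.{u}} (hK : ReflectsCollapses K) {A : SemiSSet.{u}}
    (φ : A ⟶ forget K) (hφ : ∀ n, Function.Injective (φ.app n))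
    (hr : ∀ n (s : (forget K).obj n),
      s ∈ (noncollapsing K hK).obj n ↔ ∃ x, φ.app n x = s) : anodyne φ := by
  let C := noncollapsing K hK ⊔ forgetSubcomplex (⊥ : K.Subcomplex)
  have hC (n) (s : (forget K).obj n) : s ∈ C.obj n ↔ ∃ x, φ.app n x = s := by
    rw [← hr]
    exact ⟨fun h ↦ h.resolve_right (fun h ↦ h), Or.inl⟩
  let ψ : A ⟶ C.toFunctor := Subfunctor.lift φ (by
    rintro n _ ⟨x, rfl⟩
    exact (hC n _).2 ⟨x, rfl⟩)
  have : ∀ n, IsIso (ψ.app n) := by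
    intro n
    rw [isIso_iff_bijective]
    refine ⟨fun x y h ↦ hφ n (congrArg Subtype.val h), fun ⟨s, hs⟩ ↦ ?_⟩
    obtain ⟨x, rfl⟩ := (hC n s).1 hs
    exact ⟨x, rfl⟩
  have : IsIso ψ := NatIso.isIso_of_isIso_app ψ
  exact (anodyne_of_isIso ψ).comp (anodyne_noncollapsing_sup hK ⊥)

/-- The unit identifies `A` with the noncollapsing simplices of `L A`. -/
lemma anodyne_unit (A : SemiSSet.{u}) : anodyne (unit A) := by
  refine anodyne_of_range_eq (reflectsCollapses_free A) (unit A) ?_ ?_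
  · rintro n x y (h : FreeSimplex.ofSimplex x = FreeSimplex.ofSimplex y)
    simpa [FreeSimplex.ofSimplex] using h
  · intro n (s : FreeSimplex A (toSimplexCategory.obj n.unop))
    constructor
    · intro h
      have hinj : Function.Injective s.proj.toOrderHom := by
        intro i j hij
        by_contra hne
        obtain hlt | hlt := lt_or_gt_of_ne hne
        · exact h i j hlt ((FreeSimplex.collapses_iff _ hlt.le).2 hij)
        · exact h j i hlt ((FreeSimplex.collapses_iff _ hlt.le).2 hij.symm)
      obtain ⟨b, p, hp, x⟩ := s
      have hb : b = n.unop := by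
        apply SemiSimplexCategory.ext
        have := SimplexCategory.len_le_of_epi p
        have := @SimplexCategory.len_le_of_mono _ _ p
          (SimplexCategory.mono_iff_injective.2 hinj)
        exact le_antisymm ‹_› ‹_›
      subst hb
      have : p = 𝟙 _ := SimplexCategory.eq_id_of_epi p
      subst this
      exact ⟨x, rfl⟩
    · rintro ⟨x, rfl⟩ i j hij h
      exact hij.ne ((FreeSimplex.collapses_iff (FreeSimplex.ofSimplex x) hij.le).1 h)

/-- The inclusion of `A ⊗ B` into `U (L A × L B)`. Its image consists of the noncollapsing
simplices. -/
noncomputable def geometricInclusion (A B : SemiSSet.{u}) :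
    geometricProduct A B ⟶ forget (free A ⊗ free B) where
  app _ := ↾fun s ↦ (show (free A ⊗ free B).obj _ from s.1)
  naturality _ _ _ := rfl

lemma anodyne_geometricInclusion (A B : SemiSSet.{u}) : anodyne (geometricInclusion A B) := by
  have hAB := (reflectsCollapses_free A).tensor (reflectsCollapses_free B)
  refine anodyne_of_range_eq hAB _ ?_ ?_
  · intro _ x y h
    exact Subtype.ext h
  · intro n (s : FreeSimplex A (toSimplexCategory.obj n.unop) ×
      FreeSimplex B (toSimplexCategory.obj n.unop))
    have key (i j) (hij : i ≤ j) : Collapses (K := free A ⊗ free B) s i j ↔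
        s.1.proj.toOrderHom i = s.1.proj.toOrderHom j ∧
          s.2.proj.toOrderHom i = s.2.proj.toOrderHom j :=
      Prod.ext_iff.trans (and_congr (FreeSimplex.collapses_iff s.1 hij)
        (FreeSimplex.collapses_iff s.2 hij))
    constructor
    · intro h
      refine ⟨⟨s, fun i j h1 h2 ↦ ?_⟩, rfl⟩
      by_contra hne
      obtain hlt | hlt := lt_or_gt_of_ne hne
      · exact h i j hlt ((key i j hlt.le).2 ⟨h1, h2⟩)
      · exact h j i hlt ((key j i hlt.le).2 ⟨h1.symm, h2.symm⟩)
    · rintro ⟨⟨x, hx⟩, rfl⟩ i j hij h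
      exact hij.ne (hx i j ((key i j hij.le).1 h).1 ((key i j hij.le).1 h).2)

end SemiSSet

namespace SemiSSet

open SemiSimplexCategory SSet MonoidalCategory

section Horn

/-- The monotone map underlying a simplex of `U Δ[d]`. -/
def forgetStdSimplexHom {d m : ℕ} (y : (forget (Δ[d] : SSet.{u})).obj (op ⦋m⦌ₛ)) :
    Fin (m + 1) →o Fin (d + 1) :=
  SSet.stdSimplex.asOrderHom (n := d) (m := op ⦋m⦌) y

lemma forgetStdSimplexHom_injective {d m : ℕ} :
    Function.Injective (forgetStdSimplexHom.{u} (d := d) (m := m)) := by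
  intro y y' h
  apply SSet.stdSimplex.objEquiv.injective
  exact SimplexCategory.Hom.ext _ _ h

lemma forgetStdSimplexHom_map {d m l : ℕ} (f : ⦋l⦌ₛ ⟶ ⦋m⦌ₛ)
    (y : (forget (Δ[d] : SSet.{u})).obj (op ⦋m⦌ₛ)) (i : Fin (l + 1)) :
    forgetStdSimplexHom ((forget (Δ[d] : SSet.{u})).map f.op y) i =
      forgetStdSimplexHom y (homEquiv f i) := rfl

lemma mem_noncollapsing_stdSimplex_iff {d m : ℕ}
    (y : (forget (Δ[d] : SSet.{u})).obj (op ⦋m⦌ₛ)) :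
    y ∈ (noncollapsing _ (reflectsCollapses_stdSimplex d)).obj _ ↔
      Function.Injective (forgetStdSimplexHom y) := by
  have key (i j : Fin (m + 1)) (hij : i ≤ j) : Collapses (K := Δ[d]) (n := ⦋m⦌) y i j ↔
      forgetStdSimplexHom y i = forgetStdSimplexHom y j :=
    collapses_stdSimplex_iff (n := ⦋m⦌) y i j hij
  constructor
  · intro h i j hij
    by_contra hne
    obtain hlt | hlt := lt_or_gt_of_ne hne
    · exact h i j hlt ((key i j hlt.le).2 hij)
    · exact h j i hlt ((key j i hlt.le).2 hij.symm)
  · intro h i j hij h'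
    exact hij.ne (h ((key i j hij.le).1 h'))

lemma mem_forgetSubcomplex_horn_iff {n m : ℕ} (k : Fin (n + 2))
    (y : (forget (Δ[n + 1] : SSet.{u})).obj (op ⦋m⦌ₛ)) :
    y ∈ (forgetSubcomplex (SSet.horn.{u} (n + 1) k)).obj _ ↔
      Set.range (forgetStdSimplexHom y) ∪ {k} ≠ Set.univ := Iff.rfl

/-- A noncollapsing simplex `y` of `Δ[n + 1]` whose face `d_k' y` is not in the horn `Λ[n + 1, k]`
has `k` as the vertex opposite to that face. -/
lemma forgetStdSimplexHom_eq {n m : ℕ} {k : Fin (n + 2)} {k' : Fin (m + 2)}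
    {y : (forget (Δ[n + 1] : SSet.{u})).obj (op ⦋m + 1⦌ₛ)}
    (hy : Function.Injective (forgetStdSimplexHom y))
    (hk' : Set.range (forgetStdSimplexHom ((forget (Δ[n + 1] : SSet.{u})).map (coface k').op y)) ∪
      {k} = Set.univ) : forgetStdSimplexHom y k' = k := by
  have h : forgetStdSimplexHom y k' ∈ _ := hk' ▸ Set.mem_univ _
  refine h.resolve_left ?_
  rintro ⟨i, hi⟩
  exact Fin.succAbove_ne k' i (hy hi)

/-- The simplex of `Δⁿ⁺¹` and its `k`-th face, in the underlying semisimplicial set of the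
simplicial simplex. -/
def forgetHornPairing (n : ℕ) (k : Fin (n + 2)) :
    HornPairing (forgetSubcomplex (SSet.horn.{u} (n + 1) k))
      (noncollapsing _ (reflectsCollapses_stdSimplex (n + 1)) ⊔
        forgetSubcomplex (SSet.horn.{u} (n + 1) k)) ℕ where
  P m y k' := Function.Injective (forgetStdSimplexHom y) ∧
    Set.range (forgetStdSimplexHom ((forget (Δ[n + 1] : SSet.{u})).map (coface k').op y)) ∪ {k} =
      Set.univ
  rank _ _ := 0
  mem _ y _ h := Or.inl ((mem_noncollapsing_stdSimplex_iff y).2 h.1)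
  face_notMem _ _ _ h h' := h' h.2
  cover m x hC hA := by
    have hx := (mem_noncollapsing_stdSimplex_iff x).1 (hC.resolve_right hA)
    rw [mem_forgetSubcomplex_horn_iff, not_not] at hA
    let y : (forget (Δ[n + 1] : SSet.{u})).obj (op ⦋n + 1⦌ₛ) :=
      SSet.stdSimplex.objEquiv.{u}.symm (𝟙 ⦋n + 1⦌)
    refine ⟨n, y, k, homEquiv.symm (OrderEmbedding.ofStrictMono (forgetStdSimplexHom x)
      ((forgetStdSimplexHom x).monotone.strictMono_of_injective hx)), ⟨fun i j h ↦ h, ?_⟩, ?_,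
      le_rfl⟩
    · have h1 : Set.range (forgetStdSimplexHom
          ((forget (Δ[n + 1] : SSet.{u})).map (coface k).op y)) = Set.range k.succAbove := rfl
      rw [h1, Fin.range_succAbove, Set.compl_union_self]
    · apply forgetStdSimplexHom_injective
      ext i : 2
      rw [forgetStdSimplexHom_map]
      rfl
  rank_lt m y k' hy l f hf := by
    refine Or.inl ((mem_forgetSubcomplex_horn_iff _ _).2 fun h ↦ hf ?_)
    have hk := forgetStdSimplexHom_eq hy.1 hy.2
    rw [Set.eq_univ_iff_forall] at h ⊢
    intro j
    obtain ⟨i, hi⟩ | hj := h (forgetStdSimplexHom y j)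
    · exact Or.inl ⟨i, hy.1 hi⟩
    · exact Or.inr (hy.1 (hj.trans hk.symm))
  rank_face _ _ _ _ := rfl
  face_inj m y y' k₁ k₂ hy hy' h := by
    have hs {y : (forget (Δ[n + 1] : SSet.{u})).obj (op ⦋m + 1⦌ₛ)} {k' : Fin (m + 2)}
        (hy : Function.Injective (forgetStdSimplexHom y) ∧ Set.range (forgetStdSimplexHom
          ((forget (Δ[n + 1] : SSet.{u})).map (coface k').op y)) ∪ {k} = Set.univ) :
        Set.range (forgetStdSimplexHom y) = Set.univ := by
      rw [Set.eq_univ_iff_forall]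
      intro j
      have h : j ∈ _ := hy.2 ▸ Set.mem_univ j
      obtain ⟨i, hi⟩ | hj := h
      · exact ⟨_, hi⟩
      · exact ⟨k', (forgetStdSimplexHom_eq hy.1 hy.2).trans hj.symm⟩
    apply forgetStdSimplexHom_injective
    exact DFunLike.coe_injective
      ((((forgetStdSimplexHom y).monotone.strictMono_of_injective hy.1).range_inj
        ((forgetStdSimplexHom y').monotone.strictMono_of_injective hy'.1)).1
        ((hs hy).trans (hs hy').symm))
  face_ne m y y' k₁ k₂ hy hy' h := by
    have h1 := forgetStdSimplexHom_eq hy.1 hy.2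
    have h2 := forgetStdSimplexHom_eq hy'.1 hy'.2
    rw [← h, forgetStdSimplexHom_map, ← h2] at h1
    exact Fin.succAbove_ne k₂ k₁ (hy'.1 h1)

end Horn

/-- The underlying map of a simplicial horn inclusion is anodyne: fill the horn by the simplex, and
then add the degenerate simplices outside the horn. -/
lemma anodyne_whiskerLeft_horn_ι (n : ℕ) (k : Fin (n + 2)) :
    anodyne (Functor.whiskerLeft toSimplexCategory.op (SSet.horn.{u} (n + 1) k).ι) :=
  ((forgetHornPairing n k).anodyne le_sup_right).comp (anodyne_noncollapsing_sup _ _)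

/-- The forgetful functor from simplicial to semisimplicial sets preserves anodyne maps, since it
has a right adjoint. -/
lemma anodyne_whiskerLeft {K L : SSet.{u}} {f : K ⟶ L} (hf : SSet.anodyneExtensions f) :
    anodyne (Functor.whiskerLeft toSimplexCategory.op f) := by
  intro E B p hp
  have adj := toSimplexCategory.op.ranAdjunction (Type u)
  have h := hf ((toSimplexCategory.op.ran (H := Type u)).map p) (by
    rw [modelCategoryQuillen.fibrations_eq]
    intro _ _ i hi
    simp only [modelCategoryQuillen.J, MorphismProperty.iSup_iff] at hi
    obtain ⟨n, ⟨k⟩⟩ := hi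
    exact (adj.hasLiftingProperty_iff _ p).1 (anodyne_whiskerLeft_horn_ι n k p hp))
  exact (adj.hasLiftingProperty_iff f p).2 h

end SemiSSet

/-! ### Fibrations from simplicial sets -/

namespace SemiSSet

open SemiSimplexCategory SSet MonoidalCategory HomotopicalAlgebra modelCategoryQuillen

lemma map_app_of_fac {A : SemiSSet.{u}} {K : SSet.{u}} (φ : A ⟶ forget K)
    {m n : SimplexCategory} {b c : SemiSimplexCategory} {f : m ⟶ n}
    {e : m ⟶ toSimplexCategory.obj b} {i : b ⟶ c} {p : n ⟶ toSimplexCategory.obj c}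
    (h : e ≫ toSimplexCategory.map i = f ≫ p) (x : A.obj (op c)) :
    K.map e.op (φ.app _ (A.map i.op x)) = K.map f.op (K.map p.op (φ.app _ x)) := by
  have h1 : φ.app _ (A.map i.op x) = K.map (toSimplexCategory.map i).op (φ.app _ x) :=
    NatTrans.naturality_apply φ i.op x
  rw [h1]
  have h2 (g : m ⟶ n) : K.map g.op (K.map p.op (φ.app _ x)) = K.map (g ≫ p).op (φ.app _ x) := by
    simp
  have h3 : K.map e.op (K.map (toSimplexCategory.map i).op (φ.app _ x)) =
      K.map (e ≫ toSimplexCategory.map i).op (φ.app _ x) := by simp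
  rw [h2, h3, h]

/-- The map `L A → K` corresponding to a map `A → U K`. -/
noncomputable def freeLift {A : SemiSSet.{u}} {K : SSet.{u}} (φ : A ⟶ forget K) : free A ⟶ K where
  app n := ↾fun s : FreeSimplex A n.unop ↦ K.map s.proj.op (φ.app _ s.simplex)
  naturality n m f := by
    ext s
    obtain ⟨i, hi, hi'⟩ := FreeSimplex.restrict_spec f.unop s
    change K.map (FreeSimplex.restrict f.unop s).proj.op
      (φ.app _ (FreeSimplex.restrict f.unop s).simplex) = _
    rw [hi']
    exact map_app_of_fac φ hi _

lemma unit_freeLift {A : SemiSSet.{u}} {K : SSet.{u}} (φ : A ⟶ forget K) :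
    unit A ≫ Functor.whiskerLeft _ (freeLift φ) = φ := by
  ext n x
  exact ConcreteCategory.congr_hom (K.map_id _) (φ.app n x)

/-- The inclusion of the semisimplicial `d`-simplex into the simplicial one. -/
def stdSimplexInclusion (d : ℕ) : stdSimplex.{u} d ⟶ forget Δ[d] where
  app _ := ↾fun s ↦ SSet.stdSimplex.objEquiv.{u}.symm
    (toSimplexCategory.map (stdSimplex.objEquiv s))
  naturality n m f := by
    ext s
    apply SSet.stdSimplex.objEquiv.injective
    change toSimplexCategory.map (stdSimplex.objEquiv ((stdSimplex d).map f s)) = _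
    rw [stdSimplex.objEquiv_map, Functor.map_comp]
    rfl

section Horn

variable {n : ℕ} {k : Fin (n + 2)}

/-- The simplex of the free simplicial set on `Δᵈ` given by the epi-mono factorization of a map
`t : [m] → [d]`. -/
noncomputable def freeTop {d : ℕ} {m : SimplexCategory} (t : m ⟶ ⦋d⦌) :
    FreeSimplex (stdSimplex.{u} d) m :=
  FreeSimplex.restrict t (FreeSimplex.ofSimplex (stdSimplex.objEquiv.symm (𝟙 ⦋d⦌ₛ)))

lemma freeTop_spec {d : ℕ} {m : SimplexCategory} (t : m ⟶ ⦋d⦌) :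
    (freeTop.{u} t).proj ≫ toSimplexCategory.map (stdSimplex.objEquiv (freeTop.{u} t).simplex) =
      t := by
  obtain ⟨i, hi, hi'⟩ := FreeSimplex.restrict_spec t
    (FreeSimplex.ofSimplex (stdSimplex.objEquiv.{u}.symm (𝟙 ⦋d⦌ₛ)))
  have h : stdSimplex.objEquiv (freeTop.{u} t).simplex = i := by
    refine (congrArg stdSimplex.objEquiv hi').trans ((stdSimplex.objEquiv_map _ _).trans ?_)
    exact Category.comp_id i
  exact (congrArg (fun j ↦ (freeTop.{u} t).proj ≫ toSimplexCategory.map j) h).trans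
    (hi.trans (Category.comp_id t))

lemma freeTop_map {d : ℕ} {b : SemiSimplexCategory} (f : b ⟶ ⦋d⦌ₛ) :
    freeTop.{u} (toSimplexCategory.map f) =
      FreeSimplex.ofSimplex (stdSimplex.objEquiv.symm f) := by
  refine (FreeSimplex.restrict_ofSimplex f _).trans (congrArg _ ?_)
  apply stdSimplex.objEquiv.injective
  rw [stdSimplex.objEquiv_map]
  exact Category.comp_id f

lemma freeTop_simplex_mem_horn {m : SimplexCategory} (t : m ⟶ ⦋n + 1⦌)
    (ht : Set.range t.toOrderHom ∪ {k} ≠ Set.univ) :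
    (freeTop.{u} t).simplex ∈ (horn (n + 1) k).obj _ := by
  rw [mem_horn_iff]
  have h := SimplexCategory.epi_iff_surjective.1 (freeTop.{u} t).epi
  have hr : Set.range t.toOrderHom = Set.range (stdSimplex.toFun (freeTop.{u} t).simplex) :=
    (congrArg (fun g : m ⟶ ⦋n + 1⦌ ↦ Set.range g.toOrderHom) (freeTop_spec.{u} t)).symm.trans
      (h.range_comp _)
  exact hr ▸ ht

/-- The map from a simplicial horn corresponding to a map from the semisimplicial one. -/
noncomputable def hornLift {E : SSet.{u}} (φ : (horn.{u} (n + 1) k).toFunctor ⟶ forget E) :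
    (SSet.horn.{u} (n + 1) k : SSet.{u}) ⟶ E where
  app m := ↾fun t ↦ E.map (freeTop (SSet.stdSimplex.objEquiv t.1)).proj.op
    (φ.app _ ⟨_, freeTop_simplex_mem_horn (SSet.stdSimplex.objEquiv t.1) t.2⟩)
  naturality m m' f := by
    ext t
    obtain ⟨i, hi, hi'⟩ := FreeSimplex.restrict_spec f.unop
      (freeTop.{u} (SSet.stdSimplex.objEquiv t.1))
    have h : freeTop.{u} (f.unop ≫ SSet.stdSimplex.objEquiv t.1) =
        FreeSimplex.restrict f.unop (freeTop.{u} (SSet.stdSimplex.objEquiv t.1)) :=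
      FreeSimplex.restrict_comp _ _ _
    have key (s : FreeSimplex (stdSimplex.{u} (n + 1)) m'.unop)
        (hs : s.simplex ∈ (horn (n + 1) k).obj _) (h : s = FreeSimplex.restrict f.unop
          (freeTop.{u} (SSet.stdSimplex.objEquiv t.1))) :
        E.map s.proj.op (φ.app _ ⟨s.simplex, hs⟩) = E.map f
          (E.map (freeTop (SSet.stdSimplex.objEquiv t.1)).proj.op (φ.app _ ⟨_,
            freeTop_simplex_mem_horn (SSet.stdSimplex.objEquiv t.1) t.2⟩)) := by
      subst h
      refine Eq.trans ?_ (map_app_of_fac φ hi _)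
      congr 2
      exact Subtype.ext hi'
    exact key _ _ h

lemma hornLift_map {E : SSet.{u}} (φ : (horn.{u} (n + 1) k).toFunctor ⟶ forget E)
    {b : SemiSimplexCategoryᵒᵖ} (s : (horn.{u} (n + 1) k).toFunctor.obj b) :
    (hornLift φ).app (op (toSimplexCategory.obj b.unop))
      ⟨(stdSimplexInclusion _).app b s.1, s.2⟩ = φ.app b s := by
  have key (t : FreeSimplex (stdSimplex.{u} (n + 1)) (toSimplexCategory.obj b.unop))
      (ht : t.simplex ∈ (horn (n + 1) k).obj _) (h : t = FreeSimplex.ofSimplex s.1) :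
      E.map t.proj.op (φ.app _ ⟨t.simplex, ht⟩) = φ.app b s := by
    subst h
    exact ConcreteCategory.congr_hom (E.map_id _) (φ.app b s)
  exact key _ _ (freeTop_map _)

end Horn

/-- The forgetful functor from simplicial to semisimplicial sets preserves fibrations. -/
lemma fibrations_whiskerLeft {E B : SSet.{u}} (p : E ⟶ B) [Fibration p] :
    fibrations (Functor.whiskerLeft toSimplexCategory.op p) := by
  rintro _ _ _ ⟨⟨n, k⟩⟩
  refine ⟨fun {φ v} sq ↦ ?_⟩
  let b : B.obj (op ⦋n + 1⦌) := v.app (op ⦋n + 1⦌ₛ) (stdSimplex.objEquiv.symm (𝟙 ⦋n + 1⦌ₛ))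
  have hv {c : SemiSimplexCategory} (s : (stdSimplex.{u} (n + 1)).obj (op c)) :
      v.app _ s = B.map (toSimplexCategory.map (stdSimplex.objEquiv s)).op b := by
    refine Eq.trans ?_ (NatTrans.naturality_apply v (stdSimplex.objEquiv s).op _)
    congr 1
    apply stdSimplex.objEquiv.injective
    rw [stdSimplex.objEquiv_map]
    exact (Category.comp_id _).symm
  have sq' : CommSq (hornLift φ) (SSet.horn.{u} (n + 1) k).ι p (yonedaEquiv.symm b) := ⟨by
    ext m t
    change p.app _ (E.map _ (φ.app _ _)) = B.map (SSet.stdSimplex.objEquiv t.1).op b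
    have h := ConcreteCategory.congr_hom (NatTrans.congr_app sq.w _)
      ⟨_, freeTop_simplex_mem_horn.{u} (SSet.stdSimplex.objEquiv t.1) t.2⟩
    refine (NatTrans.naturality_apply p _ _).trans
      ((congrArg (B.map _) (h.trans (hv _))).trans ?_)
    refine Eq.trans ?_ (congrArg (fun g : m.unop ⟶ ⦋n + 1⦌ ↦ B.map g.op b)
      (freeTop_spec.{u} (SSet.stdSimplex.objEquiv t.1)))
    exact (Functor.map_comp_apply B _ _ b).symm⟩
  refine ⟨⟨{
    l := stdSimplexInclusion _ ≫ Functor.whiskerLeft _ sq'.lift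
    fac_left := ?_
    fac_right := ?_ }⟩⟩
  · ext c s
    refine Eq.trans ?_ (hornLift_map φ s)
    exact ConcreteCategory.congr_hom (NatTrans.congr_app sq'.fac_left _)
      (⟨(stdSimplexInclusion _).app c s.1, s.2⟩ : (SSet.horn.{u} (n + 1) k : SSet.{u}).obj _)
  · ext c s
    refine Eq.trans ?_ (hv s).symm
    exact ConcreteCategory.congr_hom (NatTrans.congr_app sq'.fac_right _) _

lemma isFibrant_iff {X : SemiSSet.{u}} :
    IsFibrant X ↔ ∀ (n : ℕ) (k : Fin (n + 2)) (φ : (horn.{u} (n + 1) k).toFunctor ⟶ X),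
      ∃ ψ : stdSimplex (n + 1) ⟶ X, (horn (n + 1) k).ι ≫ ψ = φ := by
  constructor
  · intro hX n k φ
    have := horn_ι_llp hX n k
    have sq : CommSq φ (horn.{u} (n + 1) k).ι (terminal.from X) (terminal.from _) :=
      ⟨terminal.hom_ext _ _⟩
    exact ⟨sq.lift, sq.fac_left⟩
  · rintro h _ _ _ ⟨⟨n, k⟩⟩
    refine ⟨fun {φ v} sq ↦ ?_⟩
    obtain ⟨ψ, hψ⟩ := h n k φ
    exact ⟨⟨{ l := ψ, fac_left := hψ, fac_right := terminal.hom_ext _ _ }⟩⟩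

lemma isFibrant_forget (K : SSet.{u}) [KanComplex K] : IsFibrant (forget K) := by
  rw [isFibrant_iff]
  intro n k φ
  have := horn_ι_llp (fibrations_whiskerLeft (terminal.from K)) n k
  have hT : IsTerminal (forget (⊤_ SSet.{u})) :=
    IsTerminal.isTerminalObj ((Functor.whiskeringLeft _ _ (Type u)).obj toSimplexCategory.op) _
      terminalIsTerminal
  have sq : CommSq φ (horn.{u} (n + 1) k).ι
    (Functor.whiskerLeft toSimplexCategory.op (terminal.from K)) (hT.from _) := ⟨hT.hom_ext _ _⟩
  exact ⟨sq.lift, sq.fac_left⟩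

lemma IsFibrant.prod {X Y : SemiSSet.{u}} (hX : IsFibrant X) (hY : IsFibrant Y) :
    IsFibrant (cartesianProduct X Y) := by
  rw [isFibrant_iff] at *
  intro n k φ
  obtain ⟨ψ, hψ⟩ := hX n k (φ ≫ FunctorToTypes.prod.fst)
  obtain ⟨χ, hχ⟩ := hY n k (φ ≫ FunctorToTypes.prod.snd)
  refine ⟨FunctorToTypes.prod.lift ψ χ, ?_⟩
  ext m s
  · exact ConcreteCategory.congr_hom (NatTrans.congr_app hψ m) s
  · exact ConcreteCategory.congr_hom (NatTrans.congr_app hχ m) s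

end SemiSSet

/-! ### Homotopies -/

namespace SemiSSet

open SemiSimplexCategory SSet MonoidalCategory HomotopicalAlgebra modelCategoryQuillen

lemma freeLift_comp {A : SemiSSet.{u}} {K L : SSet.{u}} (φ : A ⟶ forget K) (g : K ⟶ L) :
    freeLift (φ ≫ Functor.whiskerLeft _ g) = freeLift φ ≫ g := by
  ext n s
  exact (NatTrans.naturality_apply g _ _).symm

/-- The map `Δ¹ ⊗ A → U (Δ[1] × L A)` that carries homotopies of simplicial sets to homotopies of
semisimplicial sets. -/
noncomputable def cylinderMap (A : SemiSSet.{u}) :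
    geometricProduct (stdSimplex 1) A ⟶ forget (Δ[1] ⊗ free A) :=
  geometricInclusion (stdSimplex 1) A ≫
    Functor.whiskerLeft _ (freeLift (stdSimplexInclusion 1) ▷ free A)

/-- The `n`-simplex of `Δ[1]` that is constant at the vertex `k`. -/
noncomputable def endpoint (k : Fin 2) (n : SimplexCategoryᵒᵖ) : (Δ[1] : SSet.{u}).obj n :=
  (freeLift (stdSimplexInclusion 1)).app n (FreeSimplex.ofVertex n.unop (vertex k))

lemma endpoint_mem_boundary (k : Fin 2) (n : SimplexCategoryᵒᵖ) :
    endpoint.{u} k n ∈ (∂Δ[1] : Δ[1].Subcomplex).obj n := by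
  intro h
  -- the other vertex is not in the image
  obtain ⟨i, hi⟩ := h (k + 1)
  have hk (k : Fin 2) : k ≠ k + 1 := by decide +revert
  exact hk k hi

/-- The map `∂Δ[1] × (K × K) → K` given by the two projections on the two ends. The end on which a
simplex of `∂Δ[1]` lies is the value at its first vertex. -/
def boundaryPairing (K : SSet.{u}) : (∂Δ[1] : SSet.{u}) ⊗ (K ⊗ K) ⟶ K where
  app n := ↾fun s : (∂Δ[1] : SSet.{u}).obj n × K.obj n × K.obj n ↦
    if SSet.stdSimplex.asOrderHom s.1.1 0 = 0 then s.2.1 else s.2.2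
  naturality n m f := by
    ext s
    -- a simplex of the boundary of `Δ[1]` is a constant map
    have h : SSet.stdSimplex.asOrderHom s.1.1 (f.unop.toOrderHom 0) =
        SSet.stdSimplex.asOrderHom s.1.1 0 := by
      by_contra hne
      have hle := (SSet.stdSimplex.asOrderHom s.1.1).monotone (Fin.zero_le (f.unop.toOrderHom 0))
      refine s.1.2 fun j ↦ ?_
      have key (a b j : Fin 2) : a < b → a = j ∨ b = j := by decide +revert
      obtain hj | hj := key _ _ j (lt_of_le_of_ne hle (Ne.symm hne))
      · exact ⟨0, hj⟩
      · exact ⟨f.unop.toOrderHom 0, hj⟩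
    change (if SSet.stdSimplex.asOrderHom s.1.1 (f.unop.toOrderHom 0) = 0 then K.map f s.2.1
      else K.map f s.2.2) = K.map f (if SSet.stdSimplex.asOrderHom s.1.1 0 = 0 then s.2.1
        else s.2.2)
    rw [h]
    split_ifs <;> rfl

/-- The map `A → U (K × K)` with components `f` and `g`. -/
def forgetPair {A : SemiSSet.{u}} {K : SSet.{u}} (f g : A ⟶ forget K) : A ⟶ forget (K ⊗ K) where
  app n := ↾fun x ↦ (f.app n x, g.app n x)
  naturality n m φ := by
    ext x
    exact congrArg₂ Prod.mk (NatTrans.naturality_apply f φ x) (NatTrans.naturality_apply g φ x)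

/-- A simplicial homotopy on `L Y` with prescribed ends on `Y` gives a homotopy of maps from `Y`. -/
lemma homotopic_of_boundary {Y : SemiSSet.{u}} {K : SSet.{u}} {f g : Y ⟶ forget K}
    (H : Δ[1] ⊗ free Y ⟶ K) (hH : (∂Δ[1] : (Δ[1] : SSet.{u}).Subcomplex).ι ▷ free Y ≫ H =
      _ ◁ freeLift (forgetPair f g) ≫ boundaryPairing K) : Homotopic f g := by
  have key (k : Fin 2) {n : SemiSimplexCategoryᵒᵖ} (y : Y.obj n) :
      (vertexInclusion (vertex k) Y ≫ cylinderMap Y ≫ Functor.whiskerLeft _ H).app n y =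
          if k = 0 then f.app n y else g.app n y := by
    refine (ConcreteCategory.congr_hom (NatTrans.congr_app hH (toSimplexCategory.op.obj n))
      ((⟨endpoint k _, endpoint_mem_boundary k _⟩, FreeSimplex.ofSimplex y) :
        (∂Δ[1] : SSet.{u}).obj _ × FreeSimplex Y _)).trans ?_
    have h1 := ConcreteCategory.congr_hom
      (NatTrans.congr_app (unit_freeLift (forgetPair f g)) n) y
    exact congrArg (fun z : K.obj _ × K.obj _ ↦ if k = 0 then z.1 else z.2) h1
  refine ⟨cylinderMap Y ≫ Functor.whiskerLeft _ H, ?_, ?_⟩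
  · ext n y
    exact key 0 y
  · ext n y
    exact key 1 y

/-- Two maps to a Kan complex `K` are homotopic if they agree along an anodyne map: the constant
path on their common restriction extends by lifting against the fibration from the path space of
`K` to `K × K`. -/
lemma homotopic_of_anodyne {X Y : SemiSSet.{u}} {K : SSet.{u}} [KanComplex K] {α : X ⟶ Y}
    (hα : anodyne α) {f g : Y ⟶ forget K} (h : α ≫ f = α ≫ g) : Homotopic f g := by
  let ι := (∂Δ[1] : (Δ[1] : SSet.{u}).Subcomplex).ι
  let ρ := (MonoidalClosed.pre ι).app K
  let c : K ⟶ (ihom Δ[1]).obj K := MonoidalClosed.curry (CartesianMonoidalCategory.snd Δ[1] K)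
  have hc : c ≫ ρ = CartesianMonoidalCategory.lift (𝟙 K) (𝟙 K) ≫
      MonoidalClosed.curry (boundaryPairing K) := by
    rw [MonoidalClosed.curry_pre_app, ← MonoidalClosed.curry_natural_left]
    congr 1
    ext n s
    exact (ite_self s.2).symm
  have sq : CommSq (α ≫ f ≫ Functor.whiskerLeft _ c) α
      (Functor.whiskerLeft toSimplexCategory.op ρ) (forgetPair f g ≫
        Functor.whiskerLeft _ (MonoidalClosed.curry (boundaryPairing K))) := ⟨by
    have h1 : α ≫ forgetPair f g =
        α ≫ f ≫ Functor.whiskerLeft _ (CartesianMonoidalCategory.lift (𝟙 K) (𝟙 K)) := by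
      ext n x
      exact congrArg (Prod.mk (f.app n (α.app n x)))
        (ConcreteCategory.congr_hom (NatTrans.congr_app h n) x).symm
    rw [reassoc_of% h1, Category.assoc, Category.assoc, ← Functor.whiskerLeft_comp,
      ← Functor.whiskerLeft_comp, hc]⟩
  have := hα _ (fibrations_whiskerLeft ρ)
  have hl : ι ▷ free Y ≫ MonoidalClosed.uncurry (freeLift sq.lift) =
      _ ◁ freeLift (forgetPair f g) ≫ boundaryPairing K := by
    rw [← MonoidalClosed.uncurry_pre_app, ← freeLift_comp, sq.fac_right, freeLift_comp,
      MonoidalClosed.uncurry_natural_left, MonoidalClosed.uncurry_curry]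
  exact homotopic_of_boundary _ hl

/-- The identity of `X` is homotopic to itself if the map `X → U K` induced by `i : L X → K` has a
retraction. -/
lemma homotopic_id {X : SemiSSet.{u}} {K : SSet.{u}} (i : free X ⟶ K) (r : forget K ⟶ X)
    (h : unit X ≫ Functor.whiskerLeft _ i ≫ r = 𝟙 X) : Homotopic (𝟙 X) (𝟙 X) := by
  have key (k : Fin 2) : vertexInclusion (vertex k) X ≫ cylinderMap X ≫
      Functor.whiskerLeft _ (CartesianMonoidalCategory.snd Δ[1] (free X) ≫ i) ≫ r = 𝟙 X := by
    ext n x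
    exact ConcreteCategory.congr_hom (NatTrans.congr_app h n) x
  exact ⟨_, key 0, key 1⟩

/-- The action of a map of semisimplicial sets on the free simplices. -/
def FreeSimplex.map {A B : SemiSSet.{u}} (π : A ⟶ B) {n : SimplexCategory} (s : FreeSimplex A n) :
    FreeSimplex B n :=
  ⟨s.base, s.proj, s.epi, π.app _ s.simplex⟩

lemma FreeSimplex.map_restrict {A B : SemiSSet.{u}} (π : A ⟶ B) {m n : SimplexCategory}
    (f : m ⟶ n) (s : FreeSimplex A n) : (restrict f s).map π = restrict f (s.map π) := by
  have h := NatTrans.naturality_apply π (face f s).op s.simplex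
  exact congrArg (fun x ↦ (⟨(restrict f s).base, (restrict f s).proj, (restrict f s).epi, x⟩ :
    FreeSimplex B m)) h

/-- The geometric product is functorial in the second variable. -/
noncomputable def geometricWhiskerLeft (C : SemiSSet.{u}) {A B : SemiSSet.{u}} (π : A ⟶ B) :
    geometricProduct C A ⟶ geometricProduct C B where
  app n := ↾fun s ↦ (⟨(s.1.1, FreeSimplex.map π s.1.2), s.2⟩ :
    {s // s ∈ (geometricSubfunctor C B).obj n})
  naturality n m f := by
    ext s
    exact Subtype.ext (Prod.ext rfl (FreeSimplex.map_restrict π _ s.1.2))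

lemma Homotopic.precomp {A X Y : SemiSSet.{u}} {f g : X ⟶ Y} (h : Homotopic f g) (π : A ⟶ X) :
    Homotopic (π ≫ f) (π ≫ g) := by
  obtain ⟨H, h₀, h₁⟩ := h
  have key (v : (stdSimplex.{u} 1).obj (op ⦋0⦌ₛ)) :
      vertexInclusion v A ≫ geometricWhiskerLeft _ π = π ≫ vertexInclusion v X := rfl
  refine ⟨geometricWhiskerLeft _ π ≫ H, ?_, ?_⟩
  · rw [← Category.assoc, key, Category.assoc, h₀]
  · rw [← Category.assoc, key, Category.assoc, h₁]

lemma Homotopic.prod_lift {A X Y : SemiSSet.{u}} {f f' : A ⟶ X} {g g' : A ⟶ Y}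
    (h : Homotopic f f') (h' : Homotopic g g') :
    Homotopic (FunctorToTypes.prod.lift f g) (FunctorToTypes.prod.lift f' g') := by
  obtain ⟨H, rfl, rfl⟩ := h
  obtain ⟨H', rfl, rfl⟩ := h'
  exact ⟨FunctorToTypes.prod.lift H H', rfl, rfl⟩

/-- The product of two maps. -/
abbrev prodMap {X X' Y Y' : SemiSSet.{u}} (f : X ⟶ X') (g : Y ⟶ Y') :
    cartesianProduct X Y ⟶ cartesianProduct X' Y' :=
  FunctorToTypes.prod.lift (FunctorToTypes.prod.fst ≫ f) (FunctorToTypes.prod.snd ≫ g)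

lemma IsHomotopyEquivalence.prodMap {X X' Y Y' : SemiSSet.{u}} {f : X ⟶ X'} {g : Y ⟶ Y'}
    (hf : IsHomotopyEquivalence f) (hg : IsHomotopyEquivalence g) :
    IsHomotopyEquivalence (prodMap f g) := by
  obtain ⟨f', h₁, h₂⟩ := hf
  obtain ⟨g', h₃, h₄⟩ := hg
  exact ⟨SemiSSet.prodMap f' g',
    (h₁.precomp FunctorToTypes.prod.fst).prod_lift (h₃.precomp FunctorToTypes.prod.snd),
    (h₂.precomp FunctorToTypes.prod.fst).prod_lift (h₄.precomp FunctorToTypes.prod.snd)⟩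

/-- An anodyne map from a fibrant object to a Kan complex is a homotopy equivalence. -/
lemma isHomotopyEquivalence_of_anodyne {X : SemiSSet.{u}} (hX : IsFibrant X) {K : SSet.{u}}
    [KanComplex K] (i : free X ⟶ K) (hα : anodyne (unit X ≫ Functor.whiskerLeft _ i)) :
    IsHomotopyEquivalence (unit X ≫ Functor.whiskerLeft _ i) := by
  have := hα _ hX
  have sq : CommSq (𝟙 X) (unit X ≫ Functor.whiskerLeft _ i) (terminal.from X) (terminal.from _) :=
    ⟨terminal.hom_ext _ _⟩
  have hr := sq.fac_left
  refine ⟨sq.lift, ?_, homotopic_of_anodyne hα ?_⟩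
  · have h := homotopic_id i sq.lift ((Category.assoc _ _ _).symm.trans hr)
    rwa [hr]
  · rw [← Category.assoc, hr, Category.id_comp, Category.comp_id]

/-- Every simplicial set has an anodyne map to a Kan complex. -/
lemma exists_anodyneExtensions_kanComplex (A : SSet.{u}) :
    ∃ (K : SSet.{u}) (_ : KanComplex K) (i : A ⟶ K), SSet.anodyneExtensions i := by
  have d := MorphismProperty.factorizationData J.{u}.rlp.llp J.{u}.rlp (terminal.from A)
  refine ⟨d.Z, ?_, d.i, d.hi⟩
  have : Fibration d.p := (modelCategoryQuillen.fibration_iff d.p).2 d.hp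
  exact (HomotopicalAlgebra.isFibrant_iff_of_isTerminal d.p terminalIsTerminal).2 this

/-- The forgetful functor preserves products. -/
def forgetTensor (K L : SSet.{u}) : forget (K ⊗ L) ⟶ cartesianProduct (forget K) (forget L) where
  app _ := ↾fun s ↦ (s.1, s.2)

instance (K L : SSet.{u}) : IsIso (forgetTensor K L) := by
  have (n : SemiSimplexCategoryᵒᵖ) : IsIso ((forgetTensor K L).app n) := by
    rw [isIso_iff_bijective]
    exact ⟨fun _ _ h ↦ h, fun s ↦ ⟨s, rfl⟩⟩
  exact NatIso.isIso_of_isIso_app _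

end SemiSSet

theorem mainTheorem5 (X Y : SemiSSet.{u}) (hX : SemiSSet.IsFibrant X)
    (hY : SemiSSet.IsFibrant Y) :
    SemiSSet.IsWeakEquivalence (SemiSSet.comparison X Y) := by
  open SemiSSet SSet MonoidalCategory in
  obtain ⟨K, _, i, hi⟩ := exists_anodyneExtensions_kanComplex (free X)
  obtain ⟨L, _, j, hj⟩ := exists_anodyneExtensions_kanComplex (free Y)
  have hα := (anodyne_unit X).comp (anodyne_whiskerLeft hi)
  have hβ := (anodyne_unit Y).comp (anodyne_whiskerLeft hj)
  have hij : SSet.anodyneExtensions (i ▷ free Y ≫ K ◁ j) :=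
    MorphismProperty.comp_mem _ _ _ (hi.whiskerRight _) (hj.whiskerLeft _)
  -- `X × Y` is its own fibrant replacement, and `U K × U L` is one of `X ⊗ Y`; both composites in
  -- the square send `(x, y)` to the pair of the images of `x` and `y`
  exact ⟨_, _, 𝟙 _, geometricInclusion X Y ≫ Functor.whiskerLeft _ (i ▷ free Y ≫ K ◁ j) ≫
    forgetTensor K L, prodMap _ _, hX.prod hY, (isFibrant_forget K).prod (isFibrant_forget L),
    anodyne_of_isIso _, (anodyne_geometricInclusion X Y).comp
      ((anodyne_whiskerLeft hij).comp (anodyne_of_isIso _)), rfl,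
    (isHomotopyEquivalence_of_anodyne hX i hα).prodMap
      (isHomotopyEquivalence_of_anodyne hY j hβ)⟩
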